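/- Conventions. Simplices are nonempty geometric simplices in some $\mathbb R^n$. A compact PL space is a subset $X=|K|\subset\mathbb R^n$ that is the union of the simplices of a finite (geometric) simplicial complex $K$; such a $K$ is called a triangulation of $X$. A PL subspace of $X$ is a space $|L'|$ with $L'$ a subcomplex of a triangulation of $X$. A PL map $X\to Y$ is a continuous map that, for some triangulations $L$ of $X$ and $K'$ of $Y$, is affine on each simplex of $L$ and sends it into a simplex of $K'$; a PL homeomorphism is a PL map that is a homeomorphism. A compact PL manifold of dimension $m$ is a compact PL space $M$ such that each point of $M$ is contained in the interior, relative to $M$, of a PL subspace that is PL homeomorphic to the $m$-simplex. The dimension of a polyhedron is the largest dimension of a simplex contained in it, with $\dim\emptyset=-\infty$. Put $I=[0,1]$. **Proposition.** Let $M\subset\mathbb R^n$ be a compact PL manifold of dimension $m$ and let $K$ be a (finite) triangulation of $M$. Then there is a PL homotopy, i.e. a PL map, $$\phi\colon M\times I\to M$$ with the following properties, where $i_0(x)=(x,0)$ and $i_1(x)=(x,1)$. (a) $\phi\circ i_0$ is the identity of $M$. (b) If $\sigma$ and $\tau$ are any simplices of $K$, then $(\phi\circ i_1)(\sigma)$ and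 $\tau$ are in general position, i.e. $$\dim\bigl((\phi\circ i_1)(\sigma)\cap\tau\bigr)\le\dim\bigl((\phi\circ i_1)(\sigma)\bigr)+\dim\tau-m .$$ (c) If $\sigma$ and $\tau$ are any simplices of $K$, then $$\dim\bigl(\phi(\sigma\times I)\cap\tau\bigr)\le\max\bigl(\dim\sigma+1+\dim\tau-m,\ \dim(\sigma\cap\tau)\bigr).$$ -/

import Mathlib

open Set Topology

namespace PL

variable {E F : Type*} [AddCommGroup E] [Module ℝ E] [TopologicalSpace E]
  [AddCommGroup F] [Module ℝ F] [TopologicalSpace F]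

/-- `K` is a triangulation of the compact space `X`: a simplicial complex with `|K| = X`.
As `X` is compact, `K` has finitely many simplices (complexes are locally finite, as usual; a set
of points is not triangulated by its one-point subsets unless it is finite). -/
def IsTriangulation (K : Geometry.SimplicialComplex ℝ E) (X : Set E) : Prop :=
  K.faces.Finite ∧ K.space = X

/-- `X` is a compact PL space. -/
def IsCompactPLSpace (X : Set E) : Prop :=
  ∃ K : Geometry.SimplicialComplex ℝ E, IsTriangulation K X

/-- `A` is a PL subspace of the compact PL space `X`: a space `|L'|` with `L'` a subcomplex of a
triangulation `L` of `X`. -/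
def IsPLSubspace (A X : Set E) : Prop :=
  ∃ L L' : Geometry.SimplicialComplex ℝ E, IsTriangulation L X ∧ L' ≤ L ∧ L'.space = A

/-- `f` restricts to a PL map from the compact PL space `X` to the compact PL space `Y`: it is
continuous on `X`, and for some triangulations `L` of `X` and `K'` of `Y` it is affine on each
simplex of `L`, with image in a simplex of `K'`. The values of `f` outside `X` are irrelevant. -/
def IsPLMap (f : E → F) (X : Set E) (Y : Set F) : Prop :=
  ContinuousOn f X ∧
    ∃ (L : Geometry.SimplicialComplex ℝ E) (K' : Geometry.SimplicialComplex ℝ F),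
      IsTriangulation L X ∧ IsTriangulation K' Y ∧
        ∀ s ∈ L.faces,
          (∃ g : E →ᵃ[ℝ] F, EqOn f g (convexHull ℝ (s : Set E))) ∧
          (∃ t ∈ K'.faces, f '' convexHull ℝ (s : Set E) ⊆ convexHull ℝ (t : Set F))

/-- `f` restricts to a PL homeomorphism from `X` to `Y`: a PL map that is a homeomorphism. -/
def IsPLHomeo (f : E → F) (X : Set E) (Y : Set F) : Prop :=
  IsPLMap f X Y ∧
    ∃ g : F → E, ContinuousOn g Y ∧ MapsTo g Y X ∧ InvOn g f X Y

/-- `M` is a compact PL manifold of dimension `m`: a compact PL space, each point of which lies in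
the interior (relative to `M`) of a PL subspace of `M` that is PL homeomorphic to the standard
`m`-simplex. -/
def IsCompactPLManifold (m : ℕ) (M : Set E) : Prop :=
  IsCompactPLSpace M ∧
    ∀ x ∈ M, ∃ B : Set E, IsPLSubspace B M ∧ B ∈ 𝓝[M] x ∧
      ∃ f : E → (Fin (m + 1) → ℝ), IsPLHomeo f B (stdSimplex ℝ (Fin (m + 1)))

/-- The dimension of a polyhedron `A`: the largest dimension of a (geometric) simplex contained
in `A`; the dimension of the empty set is `-∞`. -/
noncomputable def dim (A : Set E) : EReal :=
  ⨆ (k : ℕ) (_ : ∃ p : Fin (k + 1) → E, AffineIndependent ℝ p ∧ convexHull ℝ (range p) ⊆ A),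
    ((k : ℝ) : EReal)

/-- `A` and `B` are in general position in an `m`-dimensional manifold. -/
def InGeneralPosition (m : ℕ) (A B : Set E) : Prop :=
  dim (A ∩ B) ≤ dim A + dim B - ((m : ℝ) : EReal)

end PL

/-! The homotopy is a composite of finitely many local moves, each chosen generically. A point `x₀`
of `M` has a chart `f` onto a convex body `D ⊆ ℝᵐ` with nonempty interior. Fix `c` in the interior
of `D`. For `v` in a small ball about `c - f x₀`, let `H v` carry `x` at time `u` to the point with
chart coordinate `f x + ρ • v`, where the piecewise affine bump `ρ` depends on `f x` and `u`,
vanishes at `u = 0` and away from `f x₀`, and is small and flat enough that each stage is injective.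
Aiming at an interior point keeps the motion inside `D`, even when `x₀` is a boundary point of `M`.

Where `ρ > 0` the parameter can be recovered from a point and its image `w`: `v = ρ⁻¹ • (f w - f
x)`. Hence the triples `(x, u, w)` with `x ∈ σ`, `u > 0`, `w ∈ τ` and `w` the image of `x` at time
`u` lie in the fibre over `v` of a map to `ℝᵐ` from a set of dimension at most `dim σ + 1 + dim τ`.
This map is countably Lipschitz, and almost every fibre of such a map has Hausdorff codimension at
least `m`, and is empty if the expected dimension is negative (`ae_dimLESub_fiber`). Fixing `u = 1`
saves one dimension. So almost every `v` works for all pairs of simplices at once.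

If homotopies are composed stage by stage (`IsGenericHomotopy.exists_extend`), a point that the new
move leaves alone keeps the earlier estimate, and a point that it moves obtains the new one. By
compactness, finitely many moves cover `M`. For (c), time `0` contributes only `σ ∩ τ`. For (b),
injectivity at time `1` ensures that the image of `σ` has dimension at least `dim σ`. It remains to
see that piecewise affine maps of compact polyhedra are PL in the sense of triangulations
(`IsPiecewiseAffine.isPLMap`), which is done with hyperplane arrangements. -/

namespace PL

open MeasureTheory Filter
open scoped ENNReal NNReal

/-! ### Countably Lipschitz maps and Hausdorff dimension -/

section CountablyLipschitz

variable {α β γ : Type*} [PseudoEMetricSpace α] [PseudoEMetricSpace β] [PseudoEMetricSpace γ]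

/-- `f` is Lipschitz on each member of some countable cover of `X`. -/
def CountablyLipschitzOn (f : α → β) (X : Set α) : Prop :=
  ∃ A : ℕ → Set α, X ⊆ ⋃ n, A n ∧ ∀ n, ∃ C : ℝ≥0, LipschitzOnWith C f (X ∩ A n)

theorem CountablyLipschitzOn.of_countable {ι : Type*} [Countable ι] {f : α → β} {X : Set α}
    (A : ι → Set α) (hA : X ⊆ ⋃ i, A i) (h : ∀ i, ∃ C : ℝ≥0, LipschitzOnWith C f (X ∩ A i)) :
    CountablyLipschitzOn f X := by
  rcases isEmpty_or_nonempty ι with hι | hι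
  · refine ⟨fun _ => ∅, fun x hx => ?_, fun n => ⟨0, by simp⟩⟩
    simpa using hA hx
  · obtain ⟨e, he⟩ := exists_surjective_nat ι
    refine ⟨fun n => A (e n), ?_, fun n => h (e n)⟩
    rwa [he.iUnion_comp (g := A)]

theorem _root_.LipschitzOnWith.countablyLipschitzOn {f : α → β} {X : Set α} {C : ℝ≥0}
    (h : LipschitzOnWith C f X) : CountablyLipschitzOn f X :=
  ⟨fun _ => univ, by rw [iUnion_const]; exact subset_univ _, fun _ => ⟨C, by simpa using h⟩⟩

theorem _root_.LipschitzWith.countablyLipschitzOn {f : α → β} {C : ℝ≥0}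
    (h : LipschitzWith C f) (X : Set α) : CountablyLipschitzOn f X :=
  h.lipschitzOnWith.countablyLipschitzOn

theorem CountablyLipschitzOn.mono {f : α → β} {X Y : Set α} (h : CountablyLipschitzOn f X)
    (hY : Y ⊆ X) : CountablyLipschitzOn f Y := by
  obtain ⟨A, hA, hL⟩ := h
  refine ⟨A, hY.trans hA, fun n => ?_⟩
  obtain ⟨C, hC⟩ := hL n
  exact ⟨C, hC.mono (inter_subset_inter_left _ hY)⟩

theorem CountablyLipschitzOn.comp {f : α → β} {g : β → γ} {X : Set α} {Y : Set β}
    (hg : CountablyLipschitzOn g Y) (hf : CountablyLipschitzOn f X) (hXY : MapsTo f X Y) :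
    CountablyLipschitzOn (fun x => g (f x)) X := by
  obtain ⟨A, hA, hfA⟩ := hf
  obtain ⟨B, hB, hgB⟩ := hg
  refine .of_countable (ι := ℕ × ℕ) (fun p => A p.1 ∩ f ⁻¹' B p.2) (fun x hx => ?_) fun p => ?_
  · obtain ⟨i, hi⟩ := mem_iUnion.1 (hA hx)
    obtain ⟨j, hj⟩ := mem_iUnion.1 (hB (hXY hx))
    exact mem_iUnion.2 ⟨(i, j), hi, hj⟩
  · obtain ⟨C, hC⟩ := hfA p.1
    obtain ⟨C', hC'⟩ := hgB p.2
    refine ⟨C' * C, hC'.comp (hC.mono ?_) ?_⟩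
    · exact fun x hx => ⟨hx.1, hx.2.1⟩
    · exact fun x hx => ⟨hXY hx.1, hx.2.2⟩

theorem CountablyLipschitzOn.prodMk {f : α → β} {g : α → γ} {X : Set α}
    (hf : CountablyLipschitzOn f X) (hg : CountablyLipschitzOn g X) :
    CountablyLipschitzOn (fun x => (f x, g x)) X := by
  obtain ⟨A, hA, hfA⟩ := hf
  obtain ⟨B, hB, hgB⟩ := hg
  refine .of_countable (ι := ℕ × ℕ) (fun p => A p.1 ∩ B p.2) (fun x hx => ?_) fun p => ?_
  · obtain ⟨i, hi⟩ := mem_iUnion.1 (hA hx)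
    obtain ⟨j, hj⟩ := mem_iUnion.1 (hB hx)
    exact mem_iUnion.2 ⟨(i, j), hi, hj⟩
  · obtain ⟨C, hC⟩ := hfA p.1
    obtain ⟨C', hC'⟩ := hgB p.2
    refine ⟨max C C', LipschitzOnWith.prodMk (hC.mono ?_) (hC'.mono ?_)⟩
    · exact fun x hx => ⟨hx.1, hx.2.1⟩
    · exact fun x hx => ⟨hx.1, hx.2.2⟩

end CountablyLipschitz

/-- Hausdorff dimension is stable under countable unions, so no uniform Lipschitz constant is
needed. This matters because the map recovering `v` involves `ρ⁻¹`, which is unbounded as the time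
tends to `0`. -/
theorem CountablyLipschitzOn.dimH_image_le {α β : Type*} [EMetricSpace α] [EMetricSpace β]
    {f : α → β} {X : Set α} (hf : CountablyLipschitzOn f X) : dimH (f '' X) ≤ dimH X := by
  obtain ⟨A, hA, hfA⟩ := hf
  have : f '' X ⊆ ⋃ n, f '' (X ∩ A n) := by
    rintro _ ⟨x, hx, rfl⟩
    obtain ⟨i, hi⟩ := mem_iUnion.1 (hA hx)
    exact mem_iUnion.2 ⟨i, x, ⟨hx, hi⟩, rfl⟩
  refine (dimH_mono this).trans ?_
  rw [dimH_iUnion]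
  refine iSup_le fun n => ?_
  obtain ⟨C, hC⟩ := hfA n
  exact hC.dimH_image_le.trans (dimH_mono inter_subset_left)

theorem _root_.ContDiffOn.countablyLipschitzOn {E F : Type*} [NormedAddCommGroup E]
    [NormedSpace ℝ E] [NormedAddCommGroup F] [NormedSpace ℝ F] [SecondCountableTopology E]
    {f : E → F} {U : Set E} (hf : ContDiffOn ℝ 1 f U) (hU : IsOpen U) :
    CountablyLipschitzOn f U := by
  have h : ∀ x ∈ U, ∃ t ∈ 𝓝[U] x, ∃ C : ℝ≥0, LipschitzOnWith C f t := fun x hx => by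
    obtain ⟨C, t, ht, hC⟩ := (hf.contDiffAt (hU.mem_nhds hx)).exists_lipschitzOnWith
    exact ⟨t, mem_nhdsWithin_of_mem_nhds ht, C, hC⟩
  choose! t ht hC using h
  obtain ⟨T, hTU, hT, hcov⟩ := TopologicalSpace.countable_cover_nhdsWithin ht
  have := hT.to_subtype
  refine .of_countable (ι := T) (fun i => t i) (by simpa using hcov) fun i => ?_
  obtain ⟨C, h⟩ := hC i (hTU i.2)
  exact ⟨C, h.mono inter_subset_right⟩

/-- `A` has Hausdorff dimension at most `D - m`; in particular `A` is empty if `D < m`. -/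
def DimLESub {α : Type*} [EMetricSpace α] (A : Set α) (D m : ℕ) : Prop :=
  (D < m → A = ∅) ∧ dimH A ≤ ((D - m : ℕ) : ℝ≥0∞)

section DimLESub

variable {α β : Type*} [EMetricSpace α] [EMetricSpace β] {D m : ℕ}

theorem DimLESub.mono {A B : Set α} (h : DimLESub A D m) (hBA : B ⊆ A) : DimLESub B D m :=
  ⟨fun hD => subset_eq_empty hBA (h.1 hD), (dimH_mono hBA).trans h.2⟩

theorem DimLESub.iUnion {ι : Sort*} [Countable ι] {A : ι → Set α} (h : ∀ i, DimLESub (A i) D m) :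
    DimLESub (⋃ i, A i) D m :=
  ⟨fun hD => iUnion_eq_empty.2 fun i => (h i).1 hD, by
    rw [dimH_iUnion]; exact iSup_le fun i => (h i).2⟩

theorem DimLESub.union {A B : Set α} (hA : DimLESub A D m) (hB : DimLESub B D m) :
    DimLESub (A ∪ B) D m :=
  ⟨fun hD => by rw [hA.1 hD, hB.1 hD, union_empty], by
    rw [dimH_union]; exact max_le hA.2 hB.2⟩

theorem dimLESub_empty : DimLESub (∅ : Set α) D m := ⟨fun _ => rfl, by simp⟩

theorem DimLESub.image {A : Set α} (h : DimLESub A D m) {f : α → β}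
    (hf : CountablyLipschitzOn f A) : DimLESub (f '' A) D m :=
  ⟨fun hD => by rw [h.1 hD, image_empty], hf.dimH_image_le.trans h.2⟩

end DimLESub

/-! ### Generic fibres of Lipschitz maps -/

section GenericFiber

variable {D m : ℕ}

/-- An Eilenberg-type inequality. Cut the cube into `(n + 1) ^ D` cells of side `1 / (n + 1)`. The
image of each lies in a ball of volume at most `(2C / (n + 1)) ^ m`, so the sum of `side ^ (D - m)`
over the cells whose ball contains `v` has integral at most `(2C) ^ m` over `v`, independently of
`n`. By Fatou its liminf is finite for almost every `v`, and this liminf bounds the Hausdorff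
measure of the fibre. -/
theorem ae_dimH_fiber_le_of_subset_cube (hmD : m ≤ D) {X : Set (Fin D → ℝ)} (hX : X ⊆ Icc 0 1)
    {h : (Fin D → ℝ) → (Fin m → ℝ)} {C : ℝ≥0} (hh : LipschitzOnWith C h X) :
    ∀ᵐ v : Fin m → ℝ, dimH (X ∩ h ⁻¹' {v}) ≤ ((D - m : ℕ) : ℝ≥0∞) := by
  classical
  let cell (n : ℕ) (k : Fin D → Fin (n + 1)) : Set (Fin D → ℝ) :=
    Icc (fun i => (k i : ℝ) / (n + 1)) (fun i => ((k i : ℝ) + 1) / (n + 1))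
  let r (n : ℕ) : ℝ := 1 / ((n : ℝ) + 1)
  have hr : ∀ n, 0 < r n := fun n => by positivity
  have hcell : ∀ n k, ∀ x ∈ cell n k, ∀ y ∈ cell n k, dist x y ≤ r n := by
    intro n k x hx y hy
    refine (dist_pi_le_iff (hr n).le).2 fun i => ?_
    have := Real.dist_le_of_mem_Icc ⟨hx.1 i, hx.2 i⟩ ⟨hy.1 i, hy.2 i⟩
    refine this.trans (le_of_eq ?_)
    simp only [r]; ring
  have hcover : ∀ n, ∀ x ∈ X, ∃ k, x ∈ cell n k := by
    intro n x hx
    have h0 : ∀ i, 0 ≤ x i := fun i => (hX hx).1 i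
    have h1 : ∀ i, x i ≤ 1 := fun i => (hX hx).2 i
    have hn : (0 : ℝ) < n + 1 := by positivity
    refine ⟨fun i => ⟨min ⌊x i * (n + 1)⌋₊ n, by omega⟩, fun i => ?_, fun i => ?_⟩
    · simp only [div_le_iff₀ hn]
      refine le_trans ?_ (Nat.floor_le (mul_nonneg (h0 i) hn.le))
      exact_mod_cast min_le_left _ _
    · simp only [le_div_iff₀ hn]
      rcases le_total ⌊x i * (n + 1)⌋₊ n with h | h
      · rw [min_eq_left h]; exact (Nat.lt_floor_add_one _).le
      · rw [min_eq_right h]; nlinarith [h1 i]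
  -- The image of `X ∩ cell n k` need not be measurable, so a closed ball containing it is used
  -- instead.
  let T (n : ℕ) (k : Fin D → Fin (n + 1)) : Set (Fin m → ℝ) :=
    if hk : (X ∩ cell n k).Nonempty then Metric.closedBall (h hk.some) (C * r n) else ∅
  have hT : ∀ n k, MeasurableSet (T n k) := by
    intro n k
    simp only [T]
    split_ifs
    · exact Metric.isClosed_closedBall.measurableSet
    · exact MeasurableSet.empty
  have hTvol : ∀ n k, volume (T n k) ≤ ENNReal.ofReal ((2 * (C * r n)) ^ m) := by
    intro n k
    simp only [T]
    split_ifs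
    · rw [Real.volume_pi_closedBall _ (by have := hr n; positivity), Fintype.card_fin]
    · simp
  have hmem : ∀ n k, ∀ x ∈ X, x ∈ cell n k → h x ∈ T n k := by
    intro n k x hx hxk
    have hne : (X ∩ cell n k).Nonempty := ⟨x, hx, hxk⟩
    simp only [T, dif_pos hne]
    have h1 := hh.dist_le_mul x hx hne.some hne.some_mem.1
    refine h1.trans ?_
    gcongr
    exact hcell n k x hxk _ hne.some_mem.2
  let w (n : ℕ) : ℝ≥0∞ := ENNReal.ofReal (r n) ^ (D - m)
  let G (n : ℕ) (v : Fin m → ℝ) : ℝ≥0∞ := ∑ k, (T n k).indicator (fun _ => w n) v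
  have hGmeas : ∀ n, Measurable (G n) := fun n =>
    Finset.measurable_sum _ fun k _ => measurable_const.indicator (hT n k)
  have hGint : ∀ n, ∫⁻ v, G n v ≤ ENNReal.ofReal ((2 * C) ^ m) := by
    intro n
    simp only [G]
    rw [lintegral_finsetSum _ fun k _ => measurable_const.indicator (hT n k)]
    calc ∑ k, ∫⁻ v, (T n k).indicator (fun _ => w n) v
        ≤ ∑ _k : Fin D → Fin (n + 1), w n * ENNReal.ofReal ((2 * (C * r n)) ^ m) := by
          refine Finset.sum_le_sum fun k _ => ?_
          rw [lintegral_indicator (hT n k), setLIntegral_const]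
          gcongr
          exact hTvol n k
      _ = ENNReal.ofReal ((2 * C) ^ m) := by
          have hrn := hr n
          have hC : (0 : ℝ) ≤ C := C.2
          simp only [Finset.sum_const, Finset.card_univ, Fintype.card_fun, Fintype.card_fin, w,
            nsmul_eq_mul]
          rw [← ENNReal.ofReal_pow hrn.le, ← ENNReal.ofReal_mul (by positivity),
            ← ENNReal.ofReal_natCast, ← ENNReal.ofReal_mul (by positivity)]
          congr 1
          have : ((n + 1) ^ D : ℝ) * r n ^ D = 1 := by
            rw [← mul_pow]; simp only [r]; rw [mul_one_div_cancel (by positivity), one_pow]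
          push_cast
          calc ((n : ℝ) + 1) ^ D * (r n ^ (D - m) * (2 * (C * r n)) ^ m)
              = (((n : ℝ) + 1) ^ D * r n ^ (D - m + m)) * (2 * C) ^ m := by
                rw [pow_add]; ring
            _ = (2 * C) ^ m := by rw [Nat.sub_add_cancel hmD, this, one_mul]
  have hfin : ∫⁻ v, liminf (fun n => G n v) atTop ≠ ⊤ := by
    refine ne_top_of_le_ne_top ?_ (lintegral_liminf_le hGmeas)
    refine ne_top_of_le_ne_top (ENNReal.ofReal_ne_top (r := (2 * C) ^ m)) ?_
    exact (liminf_le_liminf (.of_forall hGint)).trans_eq (liminf_const _)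
  filter_upwards [ae_lt_top (Measurable.liminf hGmeas) hfin] with v hv
  have hmeas : μH[((D - m : ℕ) : ℝ)] (X ∩ h ⁻¹' {v}) ≤ liminf (fun n => G n v) atTop := by
    have hr0 : Tendsto (fun n => ENNReal.ofReal (r n)) atTop (𝓝 0) := by
      have := ENNReal.tendsto_ofReal (tendsto_one_div_add_atTop_nhds_zero_nat (𝕜 := ℝ))
      simpa [r] using this
    have hdiam : ∀ n k, Metric.ediam (cell n k) ≤ ENNReal.ofReal (r n) := fun n k =>
      Metric.ediam_le fun x hx y hy => by
        rw [edist_dist]; exact ENNReal.ofReal_le_ofReal (hcell n k x hx y hy)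
    refine (Measure.hausdorffMeasure_le_liminf_sum (ι := fun n => {k // v ∈ T n k})
      ((D - m : ℕ) : ℝ) (X ∩ h ⁻¹' {v}) (l := atTop) (fun n => ENNReal.ofReal (r n)) hr0
      (fun n k => cell n k.1) (.of_forall fun n k => hdiam n k.1)
      (.of_forall fun n x hx => ?_)).trans (liminf_le_liminf (.of_forall fun n => ?_))
    · obtain ⟨k, hk⟩ := hcover n x hx.1
      refine mem_iUnion.2 ⟨⟨k, ?_⟩, hk⟩
      have := hmem n k x hx.1 hk
      rwa [show h x = v from hx.2] at this
    · simp only [G]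
      rw [← Finset.sum_filter_add_sum_filter_not Finset.univ (fun k => v ∈ T n k)]
      refine le_add_right ?_
      rw [← Finset.sum_subtype (Finset.univ.filter fun k => v ∈ T n k) (by simp)
        (fun k => Metric.ediam (cell n k) ^ ((D - m : ℕ) : ℝ))]
      refine Finset.sum_le_sum fun k hk => ?_
      rw [indicator_of_mem (Finset.mem_filter.1 hk).2, ENNReal.rpow_natCast]
      exact pow_le_pow_left' (hdiam n k) _
  have := dimH_le_of_hausdorffMeasure_ne_top (d := ((D - m : ℕ) : ℝ≥0)) (s := X ∩ h ⁻¹' {v})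
    (by rw [NNReal.coe_natCast]; exact (hmeas.trans_lt hv).ne)
  simpa using this

/-- If `D < m` the image has Hausdorff dimension below `m`, hence is null, and almost every fibre is
empty. Otherwise the Lipschitz pieces are cut further by the integer translates of the unit cube. -/
theorem ae_dimLESub_fiber_pi {X : Set (Fin D → ℝ)} {h : (Fin D → ℝ) → (Fin m → ℝ)}
    (hh : CountablyLipschitzOn h X) :
    ∀ᵐ v : Fin m → ℝ, DimLESub (X ∩ h ⁻¹' {v}) D m := by
  rcases lt_or_ge D m with hD | hD
  · have h0 : volume (h '' X) = 0 := by
      have : dimH (h '' X) < m := by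
        refine (hh.dimH_image_le.trans (dimH_mono (subset_univ _))).trans_lt ?_
        rw [Real.dimH_univ_pi_fin]
        exact_mod_cast hD
      have h1 := hausdorffMeasure_of_dimH_lt (d := (m : ℝ≥0)) (s := h '' X) (by simpa using this)
      have h2 := hausdorffMeasure_pi_real (ι := Fin m)
      rw [← h2]
      simpa using h1
    filter_upwards [measure_eq_zero_iff_ae_notMem.1 h0] with v hv
    have : X ∩ h ⁻¹' {v} = ∅ := by
      ext x
      simp only [mem_inter_iff, mem_preimage, mem_singleton_iff, mem_empty_iff_false, iff_false]
      exact fun hx => hv ⟨x, hx.1, hx.2⟩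
    rw [this]
    exact dimLESub_empty
  · obtain ⟨A, hA, hhA⟩ := hh
    have key : ∀ (n : ℕ) (z : Fin D → ℤ), ∀ᵐ v : Fin m → ℝ,
        DimLESub ((X ∩ A n ∩ Icc (fun i => (z i : ℝ)) (fun i => (z i : ℝ) + 1)) ∩ h ⁻¹' {v})
          D m := by
      intro n z
      obtain ⟨C, hC⟩ := hhA n
      let e : (Fin D → ℝ) → (Fin D → ℝ) := fun x i => x i + z i
      have he : LipschitzWith 1 e := LipschitzWith.of_dist_le_mul fun x y => by
        have : e x = x + fun i => (z i : ℝ) := rfl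
        have h2 : e y = y + fun i => (z i : ℝ) := rfl
        rw [this, h2, dist_add_right]; simp
      let Y : Set (Fin D → ℝ) :=
        e ⁻¹' (X ∩ A n ∩ Icc (fun i => (z i : ℝ)) (fun i => (z i : ℝ) + 1))
      have hY : Y ⊆ Icc 0 1 := fun x hx =>
        ⟨fun i => by have := hx.2.1 i; simp only [e] at this; simpa using this,
         fun i => by
          have := hx.2.2 i; simp only [e] at this
          show x i ≤ 1
          linarith⟩
      have hL : LipschitzOnWith (C * 1) (h ∘ e) Y :=
        hC.comp he.lipschitzOnWith fun x hx => hx.1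
      filter_upwards [ae_dimH_fiber_le_of_subset_cube hD hY hL] with v hv
      refine ⟨fun h => absurd h (not_lt.2 hD), ?_⟩
      refine le_trans ?_ (le_trans (he.dimH_image_le _) hv)
      refine dimH_mono fun x hx => ⟨fun i => x i - z i, ?_, ?_⟩
      · have : e (fun i => x i - z i) = x := by funext i; simp [e]
        refine ⟨?_, ?_⟩
        · rw [mem_preimage, this]; exact hx.1
        · rw [mem_preimage, Function.comp_apply, this]; exact hx.2
      · funext i; simp [e]
    have key2 := ae_all_iff.2 fun n => ae_all_iff.2 fun z => key n z
    filter_upwards [key2] with v hv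
    refine (DimLESub.iUnion fun n => DimLESub.iUnion fun z => hv n z).mono fun x hx => ?_
    obtain ⟨n, hn⟩ := mem_iUnion.1 (hA hx.1)
    refine mem_iUnion.2 ⟨n, mem_iUnion.2 ⟨fun i => ⌊x i⌋, ⟨⟨hx.1, hn⟩, fun i => ?_, fun i => ?_⟩,
      hx.2⟩⟩
    · exact Int.floor_le _
    · exact (Int.lt_floor_add_one _).le

/-- Almost every fibre of a countably Lipschitz map to `ℝᵐ` has codimension at least `m`. -/
theorem ae_dimLESub_fiber {W : Type*} [NormedAddCommGroup W] [NormedSpace ℝ W]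
    [FiniteDimensional ℝ W] {X : Set W} {h : W → (Fin m → ℝ)} (hh : CountablyLipschitzOn h X) :
    ∀ᵐ v : Fin m → ℝ, DimLESub (X ∩ h ⁻¹' {v}) (Module.finrank ℝ W) m := by
  let e : (Fin (Module.finrank ℝ W) → ℝ) ≃L[ℝ] W :=
    ContinuousLinearEquiv.ofFinrankEq (by simp)
  have := ae_dimLESub_fiber_pi (X := e ⁻¹' X) (h := fun x => h (e x))
    (hh.comp (e.lipschitz.countablyLipschitzOn _) (mapsTo_preimage _ _))
  filter_upwards [this] with v hv
  refine (hv.image (e.lipschitz.countablyLipschitzOn _)).mono fun x hx => ⟨e.symm x, ?_, by simp⟩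
  simpa using hx

end GenericFiber

/-! ### Convex polyhedra and piecewise affine maps -/

section Polyhedra

variable {E F G : Type*} [NormedAddCommGroup E] [NormedSpace ℝ E]
  [NormedAddCommGroup F] [NormedSpace ℝ F] [NormedAddCommGroup G] [NormedSpace ℝ G]

/-- `P` is the intersection of finitely many closed half-spaces. -/
def IsHPolyhedron (P : Set E) : Prop :=
  ∃ s : Finset (E →ᵃ[ℝ] ℝ), P = {x | ∀ a ∈ s, 0 ≤ a x}

theorem isHPolyhedron_univ : IsHPolyhedron (univ : Set E) := ⟨∅, by simp⟩

theorem IsHPolyhedron.inter {P Q : Set E} (hP : IsHPolyhedron P) (hQ : IsHPolyhedron Q) :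
    IsHPolyhedron (P ∩ Q) := by
  classical
  obtain ⟨s, rfl⟩ := hP
  obtain ⟨t, rfl⟩ := hQ
  refine ⟨s ∪ t, ?_⟩
  ext x
  simp only [mem_inter_iff, mem_ofPred_eq, Finset.mem_union]
  exact ⟨fun h a ha => ha.elim (h.1 a) (h.2 a), fun h => ⟨fun a ha => h a (.inl ha),
    fun a ha => h a (.inr ha)⟩⟩

theorem IsHPolyhedron.preimage {Q : Set F} (hQ : IsHPolyhedron Q) (g : E →ᵃ[ℝ] F) :
    IsHPolyhedron (g ⁻¹' Q) := by
  classical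
  obtain ⟨s, rfl⟩ := hQ
  refine ⟨s.image fun a => a.comp g, ?_⟩
  ext x
  simp

theorem isHPolyhedron_halfSpace (a : E →ᵃ[ℝ] ℝ) : IsHPolyhedron {x | 0 ≤ a x} :=
  ⟨{a}, by simp⟩

theorem IsHPolyhedron.iInter {ι : Type*} [Finite ι] {P : ι → Set E}
    (h : ∀ i, IsHPolyhedron (P i)) : IsHPolyhedron (⋂ i, P i) := by
  classical
  cases nonempty_fintype ι
  choose s hs using h
  refine ⟨Finset.univ.biUnion s, ?_⟩
  ext x
  simp only [mem_iInter, Finset.mem_biUnion, Finset.mem_univ, true_and, mem_ofPred_eq]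
  constructor
  · rintro h a ⟨i, hi⟩
    have := h i
    rw [hs i] at this
    exact this a hi
  · intro h i
    rw [hs i]
    exact fun a ha => h a ⟨i, ha⟩

theorem IsHPolyhedron.convex {P : Set E} (hP : IsHPolyhedron P) : Convex ℝ P := by
  obtain ⟨s, rfl⟩ := hP
  have : {x | ∀ a ∈ s, 0 ≤ a x} = ⋂ a ∈ s, a ⁻¹' Ici (0 : ℝ) := by ext; simp
  rw [this]
  exact convex_iInter₂ fun a _ => (convex_Ici 0).affine_preimage a

theorem IsHPolyhedron.isClosed [FiniteDimensional ℝ E] {P : Set E} (hP : IsHPolyhedron P) :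
    IsClosed P := by
  obtain ⟨s, rfl⟩ := hP
  have : {x | ∀ a ∈ s, 0 ≤ a x} = ⋂ a ∈ s, a ⁻¹' Ici (0 : ℝ) := by ext; simp
  rw [this]
  exact isClosed_biInter fun a _ => isClosed_Ici.preimage a.continuous_of_finiteDimensional

/-- `X` is a finite union of convex polyhedra, on each of which `f` is affine. -/
def IsPiecewiseAffine (f : E → F) (X : Set E) : Prop :=
  ∃ (ι : Type) (_ : Finite ι) (P : ι → Set E) (g : ι → E →ᵃ[ℝ] F),
    (∀ i, IsHPolyhedron (P i)) ∧ X = ⋃ i, P i ∧ ∀ i, EqOn f (g i) (P i)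

/-- `X` is a finite union of convex polyhedra. -/
def IsPolyhedral (X : Set E) : Prop :=
  ∃ (ι : Type) (_ : Finite ι) (P : ι → Set E), (∀ i, IsHPolyhedron (P i)) ∧ X = ⋃ i, P i

theorem IsHPolyhedron.isPolyhedral {P : Set E} (hP : IsHPolyhedron P) : IsPolyhedral P :=
  ⟨Unit, inferInstance, fun _ => P, fun _ => hP, by rw [iUnion_const]⟩

theorem IsPolyhedral.prod {X : Set E} {Y : Set F} (hX : IsPolyhedral X) (hY : IsPolyhedral Y) :
    IsPolyhedral (X ×ˢ Y) := by
  obtain ⟨ι, _, P, hP, rfl⟩ := hX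
  obtain ⟨κ, _, Q, hQ, rfl⟩ := hY
  refine ⟨ι × κ, inferInstance, fun i => P i.1 ×ˢ Q i.2, fun i => ?_, ?_⟩
  · exact ((hP i.1).preimage (AffineMap.fst : E × F →ᵃ[ℝ] E)).inter
      ((hQ i.2).preimage (AffineMap.snd : E × F →ᵃ[ℝ] F))
  · ext ⟨x, y⟩
    simp [mem_iUnion]

theorem IsPolyhedral.piecewiseAffine {X : Set E} (hX : IsPolyhedral X) (g : E →ᵃ[ℝ] F) :
    IsPiecewiseAffine g X := by
  obtain ⟨ι, h, P, hP, rfl⟩ := hX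
  exact ⟨ι, h, P, fun _ => g, hP, rfl, fun i x _ => rfl⟩

theorem IsPiecewiseAffine.isPolyhedral {f : E → F} {X : Set E} (hf : IsPiecewiseAffine f X) :
    IsPolyhedral X := by
  obtain ⟨ι, h, P, g, hP, rfl, -⟩ := hf
  exact ⟨ι, h, P, hP, rfl⟩

theorem IsPiecewiseAffine.congr {f f' : E → F} {X : Set E} (hf : IsPiecewiseAffine f X)
    (h : EqOn f' f X) : IsPiecewiseAffine f' X := by
  obtain ⟨ι, hι, P, g, hP, rfl, hg⟩ := hf
  exact ⟨ι, hι, P, g, hP, rfl, fun i x hx => (h (mem_iUnion.2 ⟨i, hx⟩)).trans (hg i hx)⟩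

theorem IsPiecewiseAffine.comp {f : E → F} {k : F → G} {X : Set E} {Y : Set F}
    (hk : IsPiecewiseAffine k Y) (hf : IsPiecewiseAffine f X) (h : MapsTo f X Y) :
    IsPiecewiseAffine (fun x => k (f x)) X := by
  obtain ⟨ι, _, P, g, hP, rfl, hg⟩ := hf
  obtain ⟨κ, _, Q, l, hQ, rfl, hl⟩ := hk
  refine ⟨ι × κ, inferInstance, fun i => P i.1 ∩ g i.1 ⁻¹' Q i.2, fun i => (l i.2).comp (g i.1),
    fun i => (hP i.1).inter ((hQ i.2).preimage _), ?_, ?_⟩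
  · ext x
    simp only [mem_iUnion, Prod.exists, mem_inter_iff, mem_preimage]
    refine ⟨fun ⟨i, hi⟩ => ?_, fun ⟨i, j, hi, _⟩ => ⟨i, hi⟩⟩
    obtain ⟨j, hj⟩ := mem_iUnion.1 (h (mem_iUnion.2 ⟨i, hi⟩))
    exact ⟨i, j, hi, by rwa [hg i hi] at hj⟩
  · rintro ⟨i, j⟩ x hx
    have h1 := hg i hx.1
    simp only [AffineMap.coe_comp, Function.comp_apply]
    rw [h1, hl j hx.2]

theorem IsPiecewiseAffine.affine_comp {f : E → F} {X : Set E} (hf : IsPiecewiseAffine f X)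
    (k : F →ᵃ[ℝ] G) : IsPiecewiseAffine (fun x => k (f x)) X :=
  (isHPolyhedron_univ.isPolyhedral.piecewiseAffine k).comp hf (mapsTo_univ _ _)

theorem IsPiecewiseAffine.comp_affine {k : F → G} {X : Set E} {Y : Set F}
    (hk : IsPiecewiseAffine k Y) (hX : IsPolyhedral X) (f : E →ᵃ[ℝ] F) (h : MapsTo f X Y) :
    IsPiecewiseAffine (fun x => k (f x)) X :=
  hk.comp (hX.piecewiseAffine f) h

theorem IsPiecewiseAffine.union {f : E → F} {X Y : Set E} (hX : IsPiecewiseAffine f X)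
    (hY : IsPiecewiseAffine f Y) : IsPiecewiseAffine f (X ∪ Y) := by
  obtain ⟨ι, _, P, g, hP, rfl, hg⟩ := hX
  obtain ⟨κ, _, Q, l, hQ, rfl, hl⟩ := hY
  refine ⟨ι ⊕ κ, inferInstance, Sum.elim P Q, Sum.elim g l, ?_, ?_, ?_⟩
  · rintro (i | i)
    exacts [hP i, hQ i]
  · simp [iUnion_sum]
  · rintro (i | i)
    exacts [hg i, hl i]

theorem IsPiecewiseAffine.iUnion {ι : Type} [Finite ι] {f : E → F} {X : ι → Set E}
    (h : ∀ i, IsPiecewiseAffine f (X i)) : IsPiecewiseAffine f (⋃ i, X i) := by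
  choose κ hκ P g hP hX hg using h
  refine ⟨Σ i, κ i, inferInstance, fun i => P i.1 i.2, fun i => g i.1 i.2, fun i => hP i.1 i.2, ?_,
    fun i => hg i.1 i.2⟩
  rw [iUnion_sigma]
  exact iUnion_congr hX

theorem IsPiecewiseAffine.prodMk {f : E → F} {k : E → G} {X : Set E}
    (hf : IsPiecewiseAffine f X) (hk : IsPiecewiseAffine k X) :
    IsPiecewiseAffine (fun x => (f x, k x)) X := by
  obtain ⟨ι, _, P, g, hP, rfl, hg⟩ := hf
  obtain ⟨κ, _, Q, l, hQ, hPQ, hl⟩ := hk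
  refine ⟨ι × κ, inferInstance, fun i => P i.1 ∩ Q i.2, fun i => (g i.1).prod (l i.2),
    fun i => (hP i.1).inter (hQ i.2), ?_, ?_⟩
  · ext x
    simp only [mem_iUnion, Prod.exists, mem_inter_iff]
    refine ⟨fun ⟨i, hi⟩ => ?_, fun ⟨i, j, hi, _⟩ => ⟨i, hi⟩⟩
    have : x ∈ ⋃ i, P i := mem_iUnion.2 ⟨i, hi⟩
    rw [hPQ] at this
    obtain ⟨j, hj⟩ := mem_iUnion.1 this
    exact ⟨i, j, hi, hj⟩
  · rintro ⟨i, j⟩ x hx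
    simp only [AffineMap.prod_apply]
    rw [hg i hx.1, hl j hx.2]

theorem isPiecewiseAffine_max : IsPiecewiseAffine (fun p : ℝ × ℝ => max p.1 p.2) univ := by
  let a : ℝ × ℝ →ᵃ[ℝ] ℝ := (AffineMap.fst : ℝ × ℝ →ᵃ[ℝ] ℝ) - AffineMap.snd
  have h1 : IsPiecewiseAffine (fun p : ℝ × ℝ => max p.1 p.2) {p | 0 ≤ a p} :=
    ((isHPolyhedron_halfSpace a).isPolyhedral.piecewiseAffine AffineMap.fst).congr
      fun p hp => max_eq_left (by simpa [a] using hp)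
  have h2 : IsPiecewiseAffine (fun p : ℝ × ℝ => max p.1 p.2) {p | 0 ≤ (-a) p} :=
    ((isHPolyhedron_halfSpace (-a)).isPolyhedral.piecewiseAffine AffineMap.snd).congr
      fun p hp => max_eq_right (by simpa [a] using hp)
  convert! h1.union h2
  symm
  refine eq_univ_of_forall fun p => ?_
  rcases le_total p.1 p.2 with h | h
  · exact .inr (by simpa [a] using h)
  · exact .inl (by simpa [a] using h)

section RealValued

variable {f k : E → ℝ} {X : Set E}

theorem IsPiecewiseAffine.add {f k : E → F} (hf : IsPiecewiseAffine f X)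
    (hk : IsPiecewiseAffine k X) : IsPiecewiseAffine (fun x => f x + k x) X :=
  (hf.prodMk hk).affine_comp ((AffineMap.fst : F × F →ᵃ[ℝ] F) + AffineMap.snd)

theorem IsPiecewiseAffine.sub {f k : E → F} (hf : IsPiecewiseAffine f X)
    (hk : IsPiecewiseAffine k X) : IsPiecewiseAffine (fun x => f x - k x) X :=
  (hf.prodMk hk).affine_comp ((AffineMap.fst : F × F →ᵃ[ℝ] F) - AffineMap.snd)

theorem IsPolyhedral.const (hX : IsPolyhedral X) (c : F) :
    IsPiecewiseAffine (fun _ : E => c) X :=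
  hX.piecewiseAffine (AffineMap.const ℝ E c)

theorem IsPiecewiseAffine.smul_const (hf : IsPiecewiseAffine f X) (v : F) :
    IsPiecewiseAffine (fun x => f x • v) X :=
  hf.affine_comp (LinearMap.toSpanSingleton ℝ F v).toAffineMap

theorem IsPiecewiseAffine.const_mul (hf : IsPiecewiseAffine f X) (c : ℝ) :
    IsPiecewiseAffine (fun x => c * f x) X :=
  (hf.smul_const c).congr fun x _ => by simp [mul_comm]

theorem IsPiecewiseAffine.max (hf : IsPiecewiseAffine f X) (hk : IsPiecewiseAffine k X) :
    IsPiecewiseAffine (fun x => max (f x) (k x)) X :=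
  isPiecewiseAffine_max.comp (hf.prodMk hk) (mapsTo_univ _ _)

theorem IsPiecewiseAffine.neg (hf : IsPiecewiseAffine f X) :
    IsPiecewiseAffine (fun x => -f x) X :=
  (hf.const_mul (-1)).congr fun x _ => by simp

theorem IsPiecewiseAffine.min (hf : IsPiecewiseAffine f X) (hk : IsPiecewiseAffine k X) :
    IsPiecewiseAffine (fun x => min (f x) (k x)) X :=
  (hf.neg.max hk.neg).neg.congr fun x _ => by simp [max_neg_neg]

theorem IsPiecewiseAffine.abs (hf : IsPiecewiseAffine f X) :
    IsPiecewiseAffine (fun x => |f x|) X :=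
  hf.max hf.neg

theorem IsPiecewiseAffine.sum {ι : Type*} (s : Finset ι) {f : ι → E → ℝ} (hX : IsPolyhedral X)
    (hf : ∀ i ∈ s, IsPiecewiseAffine (f i) X) :
    IsPiecewiseAffine (fun x => ∑ i ∈ s, f i x) X := by
  classical
  induction s using Finset.induction_on with
  | empty => simpa using hX.const (0 : ℝ)
  | insert i s hi ih =>
    refine ((hf i (by simp)).add (ih fun j hj => hf j (by simp [hj]))).congr fun x _ => ?_
    rw [Finset.sum_insert hi]

end RealValued

/-- The pieces are closed and finite in number, and one function `f` is given on all of them, so the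
affine formulas agree on overlaps. -/
theorem IsPiecewiseAffine.continuousOn [FiniteDimensional ℝ E] {f : E → F} {X : Set E}
    (hf : IsPiecewiseAffine f X) : ContinuousOn f X := by
  obtain ⟨ι, _, P, g, hP, rfl, hg⟩ := hf
  exact (locallyFinite_of_finite P).continuousOn_iUnion (fun i => (hP i).isClosed)
    fun i => ((g i).continuous_of_finiteDimensional.continuousOn).congr (hg i)

theorem IsPiecewiseAffine.countablyLipschitzOn [FiniteDimensional ℝ E] {f : E → F} {X : Set E}
    (hf : IsPiecewiseAffine f X) : CountablyLipschitzOn f X := by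
  obtain ⟨ι, _, P, g, hP, rfl, hg⟩ := hf
  refine .of_countable P subset_rfl fun i => ?_
  obtain ⟨C, hC⟩ := (g i).lipschitzWith_of_finiteDimensional
  refine ⟨C, fun x hx y hy => ?_⟩
  rw [hg i hx.2, hg i hy.2]
  exact hC x y

end Polyhedra

/-! ### Simplices, and PL maps as piecewise affine maps -/

section Simplices

variable {E F : Type*} [NormedAddCommGroup E] [NormedSpace ℝ E]
  [NormedAddCommGroup F] [NormedSpace ℝ F]

theorem affineIndependent_finset_iff {s : Finset E} :
    AffineIndependent ℝ ((↑) : s → E) ↔ ∀ w : E → ℝ, ∑ v ∈ s, w v = 0 → ∑ v ∈ s, w v • v = 0 →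
      ∀ v ∈ s, w v = 0 := by
  classical
  rw [affineIndependent_iff]
  constructor
  · intro h w h0 h1 v hv
    exact h Finset.univ (fun v => w v) (by rw [← h0]; exact Finset.sum_coe_sort s w)
      (by rw [← h1]; exact Finset.sum_coe_sort s (fun v => w v • v)) ⟨v, hv⟩ (Finset.mem_univ _)
  · intro h t w h0 h1 e he
    let w' : E → ℝ := fun v => if hv : v ∈ s then (if (⟨v, hv⟩ : s) ∈ t then w ⟨v, hv⟩ else 0) else 0
    have key : ∀ v : s, w' v = if v ∈ t then w v else 0 := fun v => by simp [w']
    have := h w' (by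
        rw [← Finset.sum_coe_sort s w']
        simp only [key]
        rw [Finset.sum_ite_mem, Finset.univ_inter, h0]) (by
        rw [← Finset.sum_coe_sort s (fun v => w' v • v)]
        simp only [key, ite_smul, zero_smul]
        rw [Finset.sum_ite_mem, Finset.univ_inter, h1]) e e.2
    rw [key] at this
    simpa [he] using this

theorem exists_affineBasis_extending [FiniteDimensional ℝ E] {s : Finset E}
    (hs : AffineIndependent ℝ ((↑) : s → E)) :
    ∃ (t : Finset E) (b : AffineBasis t ℝ E), s ⊆ t ∧ ∀ i, b i = i := by
  obtain ⟨t, hst, ht, htop⟩ := exists_subset_affineIndependent_affineSpan_eq_top hs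
  have hfin : t.Finite := finite_set_of_fin_dim_affineIndependent ℝ ht
  lift t to Finset E using hfin
  exact ⟨t, ⟨(↑), ht, by simpa using htop⟩, by simpa using hst, fun i => rfl⟩

/-- Extend the vertices to an affine basis: the simplex is where all barycentric coordinates are
nonnegative and those of the added vertices are also nonpositive. -/
theorem isHPolyhedron_convexHull [FiniteDimensional ℝ E] {s : Finset E}
    (hs : AffineIndependent ℝ ((↑) : s → E)) : IsHPolyhedron (convexHull ℝ (s : Set E)) := by
  classical
  obtain ⟨t, b, hst, hb⟩ := exists_affineBasis_extending hs
  have key : convexHull ℝ (s : Set E) =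
      (⋂ i : t, {x | 0 ≤ b.coord i x}) ∩
        ⋂ i : {i : t // (i : E) ∉ s}, {x | 0 ≤ (-b.coord i.1) x} := by
    have hcoord : ∀ v ∈ t, ∀ i : t, b.coord i v = if (i : E) = v then 1 else 0 := by
      intro v hv i
      have := b.coord_apply i ⟨v, hv⟩
      rw [hb] at this
      simp only [this, Subtype.ext_iff]
    apply Subset.antisymm
    · refine convexHull_min (fun v hv => ⟨mem_iInter.2 fun i => ?_, mem_iInter.2 fun i => ?_⟩) ?_
      · rw [mem_ofPred_eq, hcoord v (hst hv)]
        split_ifs <;> norm_num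
      · rw [mem_ofPred_eq, AffineMap.coe_neg, Pi.neg_apply, hcoord v (hst hv), if_neg]
        · simp
        · rintro rfl; exact i.2 hv
      · exact ((IsHPolyhedron.iInter fun i => isHPolyhedron_halfSpace _).inter
          (IsHPolyhedron.iInter fun i => isHPolyhedron_halfSpace _)).convex
    · rintro x ⟨h1, h2⟩
      simp only [mem_iInter, mem_ofPred_eq] at h1 h2
      have h3 : ∀ i : t, (i : E) ∉ s → b.coord i x = 0 := fun i hi =>
        le_antisymm (by simpa using h2 ⟨i, hi⟩) (h1 i)
      rw [← b.linear_combination_coord_eq_self x,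
        ← Finset.sum_filter_add_sum_filter_not Finset.univ (fun i : t => (i : E) ∈ s)]
      rw [Finset.sum_eq_zero (s := Finset.univ.filter fun i : t => ¬ (i : E) ∈ s), add_zero]
      · refine (convex_convexHull ℝ _).sum_mem (fun i _ => h1 i) ?_ fun i hi => ?_
        · rw [← b.sum_coord_apply_eq_one x]
          refine Finset.sum_subset (Finset.subset_univ _) fun i _ hi => h3 i ?_
          simpa using hi
        · rw [hb]
          exact subset_convexHull ℝ _ (by simpa using hi)
      · intro i hi
        rw [h3 i (by simpa using hi), zero_smul]
  rw [key]
  exact (IsHPolyhedron.iInter fun i => isHPolyhedron_halfSpace _).inter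
    (IsHPolyhedron.iInter fun i => isHPolyhedron_halfSpace _)

theorem exists_affineMap_eqOn [FiniteDimensional ℝ E] {s : Finset E}
    (hs : AffineIndependent ℝ ((↑) : s → E)) (c : E → F) : ∃ k : E →ᵃ[ℝ] F, EqOn k c s := by
  classical
  obtain ⟨t, b, hst, hb⟩ := exists_affineBasis_extending hs
  refine ⟨∑ i : t, (LinearMap.toSpanSingleton ℝ F (c i)).toAffineMap.comp (b.coord i), fun v hv => ?_⟩
  have hcoord : ∀ i : t, b.coord i v = if i = ⟨v, hst hv⟩ then 1 else 0 := by
    intro i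
    have := b.coord_apply i ⟨v, hst hv⟩
    rwa [hb] at this
  have : ∀ S : Finset t, (∑ i ∈ S, (LinearMap.toSpanSingleton ℝ F (c i)).toAffineMap.comp
      (b.coord i)) v = ∑ i ∈ S, b.coord i v • c i := by
    intro S
    induction S using Finset.induction_on with
    | empty => simp
    | insert i S hi ih => rw [Finset.sum_insert hi, Finset.sum_insert hi, ← ih]; simp
  rw [this]
  simp [hcoord]

/-- An affine relation between the images allows the barycentre to be moved a little inside the
simplex without changing its image. Injectivity turns this into a relation between the vertices. -/
theorem affineIndependent_image_of_injOn [DecidableEq F] {s : Finset E}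
    (hs : AffineIndependent ℝ ((↑) : s → E)) {a : E →ᵃ[ℝ] F}
    (ha : InjOn a (convexHull ℝ (s : Set E))) :
    AffineIndependent ℝ ((↑) : (Finset.image a s) → F) := by
  rcases s.eq_empty_or_nonempty with rfl | hne
  · rw [affineIndependent_finset_iff]; simp
  have hinj : InjOn a s := ha.mono (subset_convexHull ℝ _)
  rw [affineIndependent_finset_iff] at hs ⊢
  intro w h0 h1
  rw [Finset.sum_image hinj] at h0 h1
  have hn : (0 : ℝ) < s.card := by exact_mod_cast hne.card_pos
  set W := 1 + ∑ v ∈ s, |w (a v)| with hW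
  have hWpos : 0 < W := by positivity
  -- Small enough that the weights `1 / s.card + ε * w (a v)` stay nonnegative.
  set ε : ℝ := 1 / (s.card * W) with hε
  have hεpos : 0 < ε := by positivity
  have haff : ∀ u : E → ℝ, ∑ v ∈ s, u v = 1 → a (∑ v ∈ s, u v • v) = ∑ v ∈ s, u v • a v := by
    intro u hu
    have h := s.map_affineCombination (fun v => v) u hu a
    rw [s.affineCombination_eq_linear_combination _ _ hu,
      s.affineCombination_eq_linear_combination _ _ hu] at h
    simpa using h
  let u1 : E → ℝ := fun _ => 1 / s.card
  let u2 : E → ℝ := fun v => 1 / s.card + ε * w (a v)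
  have hu1 : ∑ v ∈ s, u1 v = 1 := by simp [u1, hn.ne']
  have hu2 : ∑ v ∈ s, u2 v = 1 := by
    simp only [u2, Finset.sum_add_distrib, ← Finset.mul_sum, h0]; simp [hn.ne']
  have hpos : ∀ v ∈ s, 0 ≤ u2 v := by
    intro v hv
    have h2 : |w (a v)| ≤ W := by
      have := Finset.single_le_sum (f := fun v => |w (a v)|) (fun _ _ => abs_nonneg _) hv
      linarith
    have h3 : ε * |w (a v)| ≤ 1 / s.card := by
      calc ε * |w (a v)| ≤ ε * W := by gcongr
        _ = 1 / s.card := by rw [hε]; field_simp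
    have h4 : -(ε * |w (a v)|) ≤ ε * w (a v) := by
      have := neg_abs_le (w (a v)); nlinarith
    simp only [u2]; linarith
  have m1 : ∑ v ∈ s, u1 v • v ∈ convexHull ℝ (s : Set E) :=
    Finset.mem_convexHull'.2 ⟨u1, fun v _ => by positivity, hu1, rfl⟩
  have m2 : ∑ v ∈ s, u2 v • v ∈ convexHull ℝ (s : Set E) :=
    Finset.mem_convexHull'.2 ⟨u2, hpos, hu2, rfl⟩
  have heq : ∑ v ∈ s, u2 v • v = ∑ v ∈ s, u1 v • v := by
    apply ha m2 m1
    rw [haff _ hu1, haff _ hu2]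
    simp only [u2, u1, add_smul, Finset.sum_add_distrib, mul_smul, ← Finset.smul_sum, h1]
    simp
  simp only [u2, u1, add_smul, Finset.sum_add_distrib, mul_smul, ← Finset.smul_sum] at heq
  have hz : ∑ v ∈ s, w (a v) • v = 0 := by
    have := add_eq_left.1 heq
    exact (smul_eq_zero.1 this).resolve_left hεpos.ne'
  intro y hy
  obtain ⟨v, hv, rfl⟩ := Finset.mem_image.1 hy
  exact hs (fun v => w (a v)) h0 hz v hv

theorem eqOn_convexHull_of_eqOn {s : Set E} {a b : E →ᵃ[ℝ] F} (h : EqOn a b s) :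
    EqOn a b (convexHull ℝ s) := by
  have hc : Convex ℝ {x | a x = b x} := by
    convert! (convex_singleton (0 : F)).affine_preimage (a - b) using 1
    ext x
    simp [sub_eq_zero]
  exact fun x hx => convexHull_min (fun v hv => h hv) hc hx

theorem IsPLMap.mapsTo {f : E → F} {X : Set E} {Y : Set F} (h : IsPLMap f X Y) : MapsTo f X Y := by
  obtain ⟨-, L, K, hL, hK, h⟩ := h
  intro x hx
  rw [← hL.2] at hx
  obtain ⟨s, hs, hxs⟩ := Geometry.SimplicialComplex.mem_space_iff.1 hx
  obtain ⟨t, ht, hst⟩ := (h s hs).2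
  rw [← hK.2]
  exact Geometry.SimplicialComplex.mem_space_iff.2 ⟨t, ht, hst (mem_image_of_mem f hxs)⟩

theorem IsTriangulation.isPiecewiseAffine [FiniteDimensional ℝ E] {X : Set E} {L : Geometry.SimplicialComplex ℝ E}
    (hL : IsTriangulation L X) {f : E → F}
    (hf : ∀ s ∈ L.faces, ∃ g : E →ᵃ[ℝ] F, EqOn f g (convexHull ℝ (s : Set E))) :
    IsPiecewiseAffine f X := by
  have := hL.1.to_subtype
  choose! g hg using hf
  -- `IsPiecewiseAffine` asks for an index type in `Type`, hence the reindexing of the faces by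
  -- `Fin`.
  obtain ⟨e⟩ : Nonempty (Fin (Nat.card L.faces) ≃ L.faces) := ⟨(Finite.equivFin _).symm⟩
  refine ⟨Fin (Nat.card L.faces), inferInstance, fun s => convexHull ℝ ((e s).1 : Set E),
    fun s => g (e s).1, fun s => isHPolyhedron_convexHull (L.indep (e s).2), ?_,
    fun s => hg _ (e s).2⟩
  rw [← hL.2, Geometry.SimplicialComplex.space, biUnion_eq_iUnion,
    e.surjective.iUnion_comp (g := fun s : L.faces => convexHull ℝ (s.1 : Set E))]

theorem IsTriangulation.isPolyhedral [FiniteDimensional ℝ E] {X : Set E} {L : Geometry.SimplicialComplex ℝ E}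
    (hL : IsTriangulation L X) : IsPolyhedral X :=
  (hL.isPiecewiseAffine (f := id) fun _ _ => ⟨AffineMap.id ℝ E, fun _ _ => rfl⟩).isPolyhedral

theorem IsTriangulation.isCompact {X : Set E} {L : Geometry.SimplicialComplex ℝ E}
    (hL : IsTriangulation L X) : IsCompact X := by
  rw [← hL.2]
  exact hL.1.isCompact_biUnion fun s _ => s.finite_toSet.isCompact_convexHull ℝ

theorem IsPLMap.isPiecewiseAffine [FiniteDimensional ℝ E] {f : E → F} {X : Set E} {Y : Set F} (h : IsPLMap f X Y) :
    IsPiecewiseAffine f X := by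
  obtain ⟨-, L, K, hL, -, h⟩ := h
  exact hL.isPiecewiseAffine fun s hs => (h s hs).1

/-- By injectivity each simplex of the domain goes to a simplex, on which the inverse is the affine
map determined by the vertices. A PL homeomorphism is only assumed to have a continuous inverse. -/
theorem IsPLMap.isPiecewiseAffine_inv [FiniteDimensional ℝ F] {f : E → F} {X : Set E} {Y : Set F} (h : IsPLMap f X Y)
    {g : F → E} (hg : MapsTo g Y X) (hfg : InvOn g f X Y) : IsPiecewiseAffine g Y := by
  classical
  have hfm := h.mapsTo
  obtain ⟨-, L, K, hL, hK, h⟩ := h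
  have := hL.1.to_subtype
  obtain ⟨e⟩ : Nonempty (Fin (Nat.card L.faces) ≃ L.faces) := ⟨(Finite.equivFin _).symm⟩
  have hsub : ∀ s ∈ L.faces, convexHull ℝ (s : Set E) ⊆ X := fun s hs => by
    rw [← hL.2]; exact Geometry.SimplicialComplex.convexHull_subset_space hs
  have hY : Y = ⋃ i, f '' convexHull ℝ ((e i).1 : Set E) := by
    apply Subset.antisymm
    · intro y hy
      have hx := hg hy
      rw [← hL.2] at hx
      obtain ⟨s, hs, hxs⟩ := Geometry.SimplicialComplex.mem_space_iff.1 hx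
      refine mem_iUnion.2 ⟨e.symm ⟨s, hs⟩, g y, ?_, hfg.2 hy⟩
      rwa [e.apply_symm_apply]
    · refine iUnion_subset fun i => ?_
      rintro _ ⟨x, hx, rfl⟩
      exact hfm (hsub _ (e i).2 hx)
  rw [hY]
  refine IsPiecewiseAffine.iUnion fun i => ?_
  obtain ⟨s, hs⟩ := e i
  obtain ⟨⟨a, ha⟩, -⟩ := h s hs
  have hinj : InjOn a (convexHull ℝ (s : Set E)) :=
    (ha.injOn_iff).1 (hfg.1.injOn.mono (hsub s hs))
  have hind := affineIndependent_image_of_injOn (L.indep hs) hinj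
  have himg : f '' convexHull ℝ (s : Set E) = convexHull ℝ ((s.image a : Finset F) : Set F) := by
    rw [ha.image_eq, a.image_convexHull, Finset.coe_image]
  obtain ⟨k, hk⟩ := exists_affineMap_eqOn hind g
  have hka : EqOn (k.comp a) (AffineMap.id ℝ E) (convexHull ℝ (s : Set E)) := by
    refine eqOn_convexHull_of_eqOn fun v hv => ?_
    have hv' := subset_convexHull ℝ _ hv
    simp only [AffineMap.coe_comp, Function.comp_apply, AffineMap.id_apply]
    rw [hk (by simpa using ⟨v, hv, rfl⟩), ← ha hv', hfg.1 (hsub s hs hv')]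
  have hpoly : IsPolyhedral (f '' convexHull ℝ (s : Set E)) := by
    rw [himg]
    exact (isHPolyhedron_convexHull hind).isPolyhedral
  refine (hpoly.piecewiseAffine k).congr ?_
  rintro _ ⟨x, hx, rfl⟩
  rw [hfg.1 (hsub s hs hx), ha hx]
  exact (hka hx).symm

end Simplices

/-! ### Triangulating polyhedra by chains of cells of a hyperplane arrangement -/

section Arrangement

variable {E : Type*} [NormedAddCommGroup E] [NormedSpace ℝ E] {κ : Type*}

/-- The open cell of `x` in the arrangement of the hyperplanes `a k = 0` is a face of that
of `y`. -/
def CellLE (a : κ → E →ᵃ[ℝ] ℝ) (x y : E) : Prop := ∀ k, a k x = 0 ∨ 0 < a k x * a k y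

variable {a : κ → E →ᵃ[ℝ] ℝ} {x y z : E}

theorem CellLE.refl (x : E) : CellLE a x x := fun k => by
  rcases eq_or_ne (a k x) 0 with h | h
  · exact .inl h
  · exact .inr (mul_self_pos.2 h)

theorem CellLE.trans (h : CellLE a x y) (h' : CellLE a y z) : CellLE a x z := fun k => by
  rcases h k with h1 | h1
  · exact .inl h1
  rcases h' k with h2 | h2
  · rw [h2] at h1; simp at h1
  · right
    have : 0 < (a k x * a k z) * (a k y * a k y) := by nlinarith [mul_pos h1 h2]
    exact pos_of_mul_pos_left this (mul_self_nonneg _)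

open Classical in
/-- The number of hyperplanes of the arrangement that miss `x`. -/
noncomputable def cellRank [Fintype κ] (a : κ → E →ᵃ[ℝ] ℝ) (x : E) : ℕ :=
  (Finset.univ.filter fun k => a k x ≠ 0).card

theorem CellLE.support_subset (h : CellLE a x y) {k : κ} (hk : a k x ≠ 0) : a k y ≠ 0 := fun h0 => by
  have := (h k).resolve_left hk
  rw [h0] at this; simp at this

theorem CellLE.symm_of_cellRank_le [Fintype κ] (h : CellLE a x y) (hr : cellRank a y ≤ cellRank a x) :
    CellLE a y x := by
  classical
  have hsub : (Finset.univ.filter fun k => a k x ≠ 0) ⊆ Finset.univ.filter fun k => a k y ≠ 0 :=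
    fun k hk => by simpa using h.support_subset (by simpa using hk)
  have heq := Finset.eq_of_subset_of_card_le hsub (by simpa [cellRank] using hr)
  intro k
  by_cases hk : a k y = 0
  · exact .inl hk
  · have : k ∈ Finset.univ.filter fun k => a k x ≠ 0 := by rw [heq]; simpa using hk
    rw [mul_comm]
    exact .inr ((h k).resolve_left (by simpa using this))

theorem CellLE.cellRank_lt [Fintype κ] (h : CellLE a x y) {k : κ} (hx : a k x = 0) (hy : a k y ≠ 0) :
    cellRank a x < cellRank a y := by
  by_contra! hr
  exact (h.symm_of_cellRank_le hr).support_subset hy hx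

theorem exists_cellLE_top [Fintype κ] {s : Set E} (hfin : s.Finite) (hne : s.Nonempty)
    (hs : ∀ u ∈ s, ∀ v ∈ s, CellLE a u v ∨ CellLE a v u) : ∃ u ∈ s, ∀ v ∈ s, CellLE a v u := by
  obtain ⟨u, hu, hmax⟩ := hfin.toFinset.exists_max_image (cellRank a) (by simpa using hne)
  refine ⟨u, by simpa using hu, fun v hv => ?_⟩
  rcases hs u (by simpa using hu) v hv with h | h
  · exact h.symm_of_cellRank_le (hmax v (by simpa using hv))
  · exact h

theorem affineMap_sum_smul {s : Finset E} (f : E →ᵃ[ℝ] ℝ) (w : E → ℝ) :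
    ∑ v ∈ s, w v * f v = f.linear (∑ v ∈ s, w v • v) + (∑ v ∈ s, w v) * f 0 := by
  have : ∀ v, f v = f.linear v + f 0 := fun v => by rw [f.decomp]; simp
  simp only [map_sum, map_smul, smul_eq_mul]
  rw [Finset.sum_mul, ← Finset.sum_add_distrib]
  refine Finset.sum_congr rfl fun v _ => ?_
  rw [this v]; ring

/-- The value of `a k` on a nonnegative combination of a chain has the sign it has on the top. -/
theorem sum_mul_top {V : Finset E} {w : E → ℝ} (hw : ∀ v, 0 ≤ w v) {u : E} (hu : u ∈ V)
    (hwu : w u ≠ 0) (htop : ∀ v ∈ V, w v ≠ 0 → CellLE a v u) (k : κ) :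
    (a k u = 0 → ∑ v ∈ V, w v * a k v = 0) ∧ (a k u ≠ 0 → 0 < (∑ v ∈ V, w v * a k v) * a k u) := by
  constructor
  · intro h
    refine Finset.sum_eq_zero fun v hv => ?_
    by_cases hwv : w v = 0
    · rw [hwv, zero_mul]
    · rcases htop v hv hwv k with h' | h'
      · rw [h', mul_zero]
      · rw [h] at h'; simp at h'
  · intro h
    rw [Finset.sum_mul]
    refine Finset.sum_pos' (fun v hv => ?_) ⟨u, hu, ?_⟩
    · by_cases hwv : w v = 0
      · simp [hwv]
      · rcases htop v hv hwv k with h' | h'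
        · simp [h']
        · rw [mul_assoc]; exact mul_nonneg (hw v) h'.le
    · rw [mul_assoc]
      exact mul_pos (lt_of_le_of_ne (hw u) hwu.symm) (mul_self_pos.2 h)

/-- The signs of the `a k` at a positive combination of a chain are those at the top of the chain,
so two combinations of equal weight and equal sum have the same top vertex. Subtracting the smaller
top weight from both shrinks a support, and induction on the total support size applies. The weights
are not normalised, so that subtraction stays within the statement. -/
theorem chain_weights_unique [Fintype κ] {V : Finset E}
    (hV : ∀ u ∈ V, ∀ v ∈ V, CellLE a u v → CellLE a v u → u = v) (n : ℕ) :
    ∀ w w' : E → ℝ, (∀ v, 0 ≤ w v) → (∀ v, 0 ≤ w' v) →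
      {v ∈ (V : Set E) | w v ≠ 0}.ncard + {v ∈ (V : Set E) | w' v ≠ 0}.ncard ≤ n →
      (∀ u ∈ V, ∀ v ∈ V, w u ≠ 0 → w v ≠ 0 → CellLE a u v ∨ CellLE a v u) →
      (∀ u ∈ V, ∀ v ∈ V, w' u ≠ 0 → w' v ≠ 0 → CellLE a u v ∨ CellLE a v u) →
      ∑ v ∈ V, w v = ∑ v ∈ V, w' v → ∑ v ∈ V, w v • v = ∑ v ∈ V, w' v • v →
      ∀ v ∈ V, w v = w' v := by
  induction n with
  | zero =>
    intro w w' _ _ hn _ _ _ _ v hv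
    have hf : ∀ w : E → ℝ, {v ∈ (V : Set E) | w v ≠ 0}.Finite :=
      fun w => V.finite_toSet.subset (sep_subset _ _)
    have h1 := (ncard_eq_zero (hf w)).1 (by omega)
    have h2 := (ncard_eq_zero (hf w')).1 (by omega)
    have e1 : w v = 0 := by
      by_contra h; exact (h1 ▸ (⟨hv, h⟩ : v ∈ {v ∈ (V : Set E) | w v ≠ 0}) : v ∈ (∅ : Set E))
    have e2 : w' v = 0 := by
      by_contra h; exact (h2 ▸ (⟨hv, h⟩ : v ∈ {v ∈ (V : Set E) | w' v ≠ 0}) : v ∈ (∅ : Set E))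
    rw [e1, e2]
  | succ n ih =>
    intro w w' hw hw' hn hc hc' hsum hpt
    have hf : ∀ w : E → ℝ, {v ∈ (V : Set E) | w v ≠ 0}.Finite :=
      fun w => V.finite_toSet.subset (sep_subset _ _)
    by_cases hs : ∑ v ∈ V, w v = 0
    · have e1 := (Finset.sum_eq_zero_iff_of_nonneg fun v _ => hw v).1 hs
      have e2 := (Finset.sum_eq_zero_iff_of_nonneg fun v _ => hw' v).1 (hsum ▸ hs)
      exact fun v hv => (e1 v hv).trans (e2 v hv).symm
    obtain ⟨u0, hu0, hwu0⟩ := Finset.exists_ne_zero_of_sum_ne_zero hs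
    obtain ⟨u0', hu0', hwu0'⟩ := Finset.exists_ne_zero_of_sum_ne_zero (hsum ▸ hs)
    obtain ⟨u, ⟨hu, hwu⟩, htop⟩ := exists_cellLE_top (a := a) (hf w) ⟨u0, hu0, hwu0⟩
      fun x hx y hy => hc x hx.1 y hy.1 hx.2 hy.2
    obtain ⟨u', ⟨hu', hwu'⟩, htop'⟩ := exists_cellLE_top (a := a) (hf w') ⟨u0', hu0', hwu0'⟩
      fun x hx y hy => hc' x hx.1 y hy.1 hx.2 hy.2
    have hT := fun k => sum_mul_top (a := a) hw hu hwu (fun v hv h => htop v ⟨hv, h⟩) k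
    have hT' := fun k => sum_mul_top (a := a) hw' hu' hwu' (fun v hv h => htop' v ⟨hv, h⟩) k
    -- The left side depends only on the total weight and the weighted sum, because `a k` is affine.
    have hL : ∀ k, ∑ v ∈ V, w v * a k v = ∑ v ∈ V, w' v * a k v := fun k => by
      rw [affineMap_sum_smul, affineMap_sum_smul, hsum, hpt]
    have key : ∀ {S p q : ℝ}, (p ≠ 0 → 0 < S * p) → (q = 0 → S = 0) → (q ≠ 0 → 0 < S * q) →
        p = 0 ∨ 0 < p * q := by
      intro S p q h1 h2 h3
      by_cases hp : p = 0
      · exact .inl hp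
      right
      have h4 := h1 hp
      have hS : S ≠ 0 := by rintro rfl; simp at h4
      have h5 := h3 fun h => hS (h2 h)
      have : 0 < (p * q) * (S * S) := by nlinarith [mul_pos h4 h5]
      exact pos_of_mul_pos_left this (mul_self_nonneg _)
    obtain rfl : u = u' := by
      refine hV u hu u' hu' (fun k => ?_) (fun k => ?_)
      · exact key (hT k).2 (fun h => by rw [hL]; exact (hT' k).1 h)
          (fun h => by rw [hL]; exact (hT' k).2 h)
      · exact key (hT' k).2 (fun h => by rw [← hL]; exact (hT k).1 h)
          (fun h => by rw [← hL]; exact (hT k).2 h)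
    classical
    set μ := min (w u) (w' u) with hμ
    have hμpos : 0 < μ := lt_min (lt_of_le_of_ne (hw u) (Ne.symm hwu))
      (lt_of_le_of_ne (hw' u) (Ne.symm hwu'))
    let red (w : E → ℝ) : E → ℝ := fun v => w v - if v = u then μ else 0
    have hred0 : ∀ w : E → ℝ, (∀ v, 0 ≤ w v) → μ ≤ w u → ∀ v, 0 ≤ red w v := by
      intro w hw h v
      simp only [red]
      split_ifs with hv
      · subst hv; linarith
      · simpa using hw v
    have hred1 : ∀ w : E → ℝ, w u ≠ 0 → ∀ v, red w v ≠ 0 → w v ≠ 0 := by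
      intro w hw v hv
      by_cases h : v = u
      · rwa [h]
      · simpa [red, h] using hv
    have hsub : ∀ w : E → ℝ, w u ≠ 0 →
        {v ∈ (V : Set E) | red w v ≠ 0} ⊆ {v ∈ (V : Set E) | w v ≠ 0} :=
      fun w hw v hv => ⟨hv.1, hred1 w hw v hv.2⟩
    have hle : ∀ w : E → ℝ, w u ≠ 0 → {v ∈ (V : Set E) | red w v ≠ 0}.ncard ≤
        {v ∈ (V : Set E) | w v ≠ 0}.ncard := fun w hw => ncard_le_ncard (hsub w hw) (hf w)
    have hlt : ∀ w : E → ℝ, w u ≠ 0 → w u = μ → {v ∈ (V : Set E) | red w v ≠ 0}.ncard <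
        {v ∈ (V : Set E) | w v ≠ 0}.ncard := fun w hw h =>
      ncard_lt_ncard ⟨hsub w hw, fun hh => (hh (⟨hu, hw⟩ : u ∈ {v ∈ (V : Set E) | w v ≠ 0})).2
        (by simp [red, h])⟩ (hf w)
    have hres := ih (red w) (red w') (hred0 w hw (min_le_left _ _)) (hred0 w' hw' (min_le_right _ _))
      (by
        have h1 := hle w hwu
        have h2 := hle w' hwu'
        rcases min_choice (w u) (w' u) with h | h
        · have := hlt w hwu (by rw [hμ, h]); omega
        · have := hlt w' hwu' (by rw [hμ, h]); omega)
      (fun x hx y hy h1 h2 => hc x hx y hy (hred1 w hwu x h1) (hred1 w hwu y h2))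
      (fun x hx y hy h1 h2 => hc' x hx y hy (hred1 w' hwu' x h1) (hred1 w' hwu' y h2))
      (by simp only [red, Finset.sum_sub_distrib, hsum])
      (by simp only [red, sub_smul, Finset.sum_sub_distrib, hpt])
    intro v hv
    simpa [red] using hres v hv

/-- The positive and negative parts of an affine relation are two nonnegative combinations with the
same total and the same sum, hence equal. -/
theorem affineIndependent_of_chain [Fintype κ] {s : Finset E}
    (hV : ∀ u ∈ s, ∀ v ∈ s, CellLE a u v → CellLE a v u → u = v)
    (hs : ∀ u ∈ s, ∀ v ∈ s, CellLE a u v ∨ CellLE a v u) :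
    AffineIndependent ℝ ((↑) : s → E) := by
  rw [affineIndependent_finset_iff]
  intro w h0 h1
  have hp : ∀ t : ℝ, max t 0 - max (-t) 0 = t := fun t => by
    rcases le_total t 0 with h | h
    · rw [max_eq_right h, max_eq_left (by linarith)]; ring
    · rw [max_eq_left h, max_eq_right (by linarith)]; ring
  have := chain_weights_unique hV _ (fun v => max (w v) 0) (fun v => max (-w v) 0)
    (fun v => le_max_right _ _) (fun v => le_max_right _ _) le_rfl
    (fun u hu v hv _ _ => hs u hu v hv) (fun u hu v hv _ _ => hs u hu v hv)
    (by rw [← sub_eq_zero, ← Finset.sum_sub_distrib]; simp only [hp, h0])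
    (by rw [← sub_eq_zero, ← Finset.sum_sub_distrib]; simp only [← sub_smul, hp, h1])
  intro v hv
  rw [← hp (w v), this v hv, sub_self]

/-- With weights extended by zero to `V`, uniqueness makes the two representations of a common point
agree, so they are supported in `s ∩ t`. -/
theorem convexHull_inter_of_chain [Fintype κ] {V : Finset E}
    (hV : ∀ u ∈ V, ∀ v ∈ V, CellLE a u v → CellLE a v u → u = v) {s t : Finset E}
    (hsV : s ⊆ V) (htV : t ⊆ V) (hs : ∀ u ∈ s, ∀ v ∈ s, CellLE a u v ∨ CellLE a v u)
    (ht : ∀ u ∈ t, ∀ v ∈ t, CellLE a u v ∨ CellLE a v u) :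
    convexHull ℝ (s : Set E) ∩ convexHull ℝ (t : Set E) ⊆ convexHull ℝ (s ∩ t : Set E) := by
  classical
  rintro x ⟨hxs, hxt⟩
  obtain ⟨w, hw0, hw1, hwx⟩ := Finset.mem_convexHull'.1 hxs
  obtain ⟨w', hw0', hw1', hwx'⟩ := Finset.mem_convexHull'.1 hxt
  let e (s : Finset E) (w : E → ℝ) : E → ℝ := fun v => if v ∈ s then w v else 0
  have he0 : ∀ (s : Finset E) (w : E → ℝ), (∀ y ∈ s, 0 ≤ w y) → ∀ v, 0 ≤ e s w v := by
    intro s w hw v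
    simp only [e]
    split_ifs with h
    exacts [hw v h, le_rfl]
  have hes : ∀ (s : Finset E) (w : E → ℝ) v, e s w v ≠ 0 → v ∈ s := by
    intro s w v h
    by_contra hv
    simp [e, hv] at h
  have hsum : ∀ (s : Finset E) (w : E → ℝ), s ⊆ V → ∑ v ∈ V, e s w v = ∑ v ∈ s, w v := by
    intro s w hsV
    simp only [e]
    rw [Finset.sum_ite_mem, Finset.inter_eq_right.2 hsV]
  have hsum2 : ∀ (s : Finset E) (w : E → ℝ), s ⊆ V →
      ∑ v ∈ V, e s w v • v = ∑ v ∈ s, w v • v := by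
    intro s w hsV
    simp only [e, ite_smul, zero_smul]
    rw [Finset.sum_ite_mem, Finset.inter_eq_right.2 hsV]
  have key := chain_weights_unique hV _ (e s w) (e t w') (he0 s w hw0) (he0 t w' hw0') le_rfl
    (fun u _ v _ h1 h2 => hs u (hes _ _ u h1) v (hes _ _ v h2))
    (fun u _ v _ h1 h2 => ht u (hes _ _ u h1) v (hes _ _ v h2))
    (by rw [hsum s w hsV, hsum t w' htV, hw1, hw1'])
    (by rw [hsum2 s w hsV, hsum2 t w' htV, hwx, hwx'])
  have hzero : ∀ v ∈ V, v ∉ s ∩ t → e s w v = 0 := by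
    intro v hv h
    by_contra hne
    exact h (Finset.mem_inter.2 ⟨hes _ _ v hne, hes _ _ v (by rwa [key v hv] at hne)⟩)
  have hst : s ∩ t ⊆ V := Finset.inter_subset_left.trans hsV
  rw [← Finset.coe_inter, Finset.mem_convexHull']
  refine ⟨e s w, fun v _ => he0 s w hw0 v, ?_, ?_⟩
  · rw [Finset.sum_subset hst hzero, hsum s w hsV, hw1]
  · rw [Finset.sum_subset hst fun v hv h => by rw [hzero v hv h, zero_smul], hsum2 s w hsV, hwx]

/-- The simplicial complex of chains of cells of an arrangement, each cell in use being represented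
by one of the points of `V`. -/
def chainComplex [Fintype κ] (a : κ → E →ᵃ[ℝ] ℝ) (V : Finset E)
    (hV : ∀ u ∈ V, ∀ v ∈ V, CellLE a u v → CellLE a v u → u = v) :
    Geometry.SimplicialComplex ℝ E where
  faces := {s | s.Nonempty ∧ s ⊆ V ∧ ∀ u ∈ s, ∀ v ∈ s, CellLE a u v ∨ CellLE a v u}
  isRelLowerSet_faces := fun _s hs => ⟨hs.1, fun _t hts ht =>
    ⟨ht, hts.trans hs.2.1, fun u hu v hv => hs.2.2 u (hts hu) v (hts hv)⟩⟩
  indep hs := affineIndependent_of_chain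
    (fun u hu v hv => hV u (hs.2.1 hu) v (hs.2.1 hv)) hs.2.2
  inter_subset_convexHull hs ht := convexHull_inter_of_chain hV hs.2.1 ht.2.1 hs.2.2 ht.2.2

/-- The ray from the representative `b` of the cell of `x` through `x` leaves the cell beyond `x`,
at a point `y` of a cell of smaller rank, because `P` is bounded. A chain for `y` followed by `b` is
a chain for `x`, as `x` lies between `b` and `y`. -/
theorem exists_chain_mem_convexHull [Fintype κ] {V : Finset E} {P : Set E} {S : Finset κ}
    (hP : P = {x | ∀ k ∈ S, 0 ≤ a k x}) (hb : Bornology.IsBounded P)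
    (hV : ∀ x ∈ P, ∃ b ∈ V, b ∈ P ∧ CellLE a b x ∧ CellLE a x b) (n : ℕ) :
    ∀ x ∈ P, cellRank a x ≤ n → ∃ s : Finset E, s.Nonempty ∧ s ⊆ V ∧
      (∀ u ∈ s, ∀ v ∈ s, CellLE a u v ∨ CellLE a v u) ∧ (∀ v ∈ s, CellLE a v x) ∧
      x ∈ convexHull ℝ (s : Set E) := by
  classical
  induction n using Nat.strong_induction_on with
  | _ n ih =>
  intro x hx hn
  obtain ⟨b, hbV, hbP, hbx, hxb⟩ := hV x hx
  by_cases hxe : x = b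
  · subst hxe
    exact ⟨{x}, by simp, by simpa using hbV, by simpa using CellLE.refl (a := a) x,
      by simpa using CellLE.refl x, by simp⟩
  -- At parameter `t` on the ray, `a k` times `a k b` equals `a k b * a k b - t * q k`; so `a k`
  -- reaches zero ahead exactly when `q k > 0`.
  let q : κ → ℝ := fun k => a k b * a k b - a k x * a k b
  have hline : ∀ (t : ℝ) k, a k (AffineMap.lineMap b x t) = a k b + t * (a k x - a k b) := by
    intro t k
    rw [AffineMap.apply_lineMap, AffineMap.lineMap_apply_module]
    simp only [smul_eq_mul]; ring
  -- If no hyperplane were reached, the whole ray would stay in the bounded set `P`.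
  have hJ : (Finset.univ.filter fun k => 0 < q k).Nonempty := by
    by_contra hJ
    rw [Finset.not_nonempty_iff_eq_empty, Finset.filter_eq_empty_iff] at hJ
    have hq : ∀ k, q k ≤ 0 := fun k => not_lt.1 (hJ (Finset.mem_univ k))
    have hray : ∀ t : ℝ, 0 ≤ t → AffineMap.lineMap b x t ∈ P := by
      intro t ht
      rw [hP] at hbP ⊢
      intro k hk
      rw [hline]
      have h1 := hbP k hk
      rcases hxb k with h2 | h2
      · have h3 : a k b = 0 := by
          by_contra h; exact hbx.support_subset h h2
        rw [h2, h3]; simp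
      · have h3 : 0 < a k b := lt_of_le_of_ne h1 fun h => by rw [← h] at h2; simp at h2
        have h4 : a k b ≤ a k x := by
          have := hq k
          simp only [q] at this
          nlinarith
        nlinarith
    obtain ⟨R, hR⟩ := hb.subset_closedBall b
    have hd : 0 < ‖x - b‖ := norm_pos_iff.2 (sub_ne_zero.2 hxe)
    have h1 := hR (hray ((|R| + 1) / ‖x - b‖) (by positivity))
    rw [Metric.mem_closedBall, dist_lineMap_left, dist_eq_norm, norm_sub_rev b x, Real.norm_eq_abs,
      abs_of_nonneg (by positivity), div_mul_cancel₀ _ hd.ne'] at h1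
    linarith [le_abs_self R]
  -- The first hyperplane reached; taking the minimum keeps `y` in the closure of the cell of `b`.
  obtain ⟨k0, hk0, hmin⟩ := Finset.exists_min_image _ (fun k => a k b * a k b / q k) hJ
  have hq0 : 0 < q k0 := by simpa using hk0
  set t := a k0 b * a k0 b / q k0 with ht
  have hb0 : a k0 b ≠ 0 := by
    intro h; simp [q, h] at hq0
  have hx0 : 0 < a k0 b * a k0 x := (hbx k0).resolve_left hb0
  have ht1 : 1 < t := by
    rw [ht, one_lt_div hq0]
    simp only [q]; linarith
  set y := AffineMap.lineMap b x t with hy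
  have hyb : ∀ k, 0 ≤ a k y * a k b := by
    intro k
    rw [hy, hline]
    have hqk : (a k b + t * (a k x - a k b)) * a k b = a k b * a k b - t * q k := by
      simp only [q]; ring
    rw [hqk]
    rcases le_or_gt (q k) 0 with h | h
    · nlinarith [mul_self_nonneg (a k b)]
    · have := hmin k (by simpa using h)
      rw [le_div_iff₀ h] at this
      linarith
  have hy0 : a k0 y = 0 := by
    have : a k0 y * a k0 b = 0 := by
      rw [hy, hline]
      have : (a k0 b + t * (a k0 x - a k0 b)) * a k0 b = a k0 b * a k0 b - t * q k0 := by
        simp only [q]; ring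
      rw [this, ht, div_mul_cancel₀ _ hq0.ne', sub_self]
    exact (mul_eq_zero.1 this).resolve_right hb0
  have hyLE : CellLE a y b := by
    intro k
    rcases eq_or_lt_of_le (hyb k) with h | h
    · rcases mul_eq_zero.1 h.symm with h' | h'
      · exact .inl h'
      · left
        have h2 : a k x = 0 := by
          by_contra hne; exact hxb.support_subset hne h'
        rw [hy, hline, h', h2]; simp
    · exact .inr h
  have hyP : y ∈ P := by
    rw [hP] at hbP ⊢
    intro k hk
    have h1 := hbP k hk
    rcases hyLE k with h | h
    · exact h.ge
    · by_contra! hneg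
      nlinarith
  have hrank : cellRank a y < cellRank a x := (hyLE.trans hbx).cellRank_lt hy0
    (hbx.support_subset hb0)
  obtain ⟨s, -, hsV, hs, hsy, hys⟩ := ih (cellRank a y) (by omega) y hyP le_rfl
  have hsb : ∀ v ∈ s, CellLE a v b := fun v hv => (hsy v hv).trans hyLE
  refine ⟨insert b s, Finset.insert_nonempty _ _, ?_, ?_, ?_, ?_⟩
  · exact Finset.insert_subset hbV hsV
  · intro u hu v hv
    rcases Finset.mem_insert.1 hu with hu | hu <;> rcases Finset.mem_insert.1 hv with hv | hv
    · rw [hu, hv]; exact .inl (CellLE.refl _)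
    · rw [hu]; exact .inr (hsb v hv)
    · rw [hv]; exact .inl (hsb u hu)
    · exact hs u hu v hv
  · intro v hv
    rcases Finset.mem_insert.1 hv with rfl | hv
    · exact hbx
    · exact (hsb v hv).trans hbx
  · have h1 : b ∈ convexHull ℝ ((insert b s : Finset E) : Set E) :=
      subset_convexHull ℝ _ (by simp)
    have h2 : y ∈ convexHull ℝ ((insert b s : Finset E) : Set E) :=
      convexHull_mono (by simp) hys
    have hx' : x = (1 - t⁻¹) • b + t⁻¹ • y := by
      have htne : t ≠ 0 := by linarith
      rw [hy, AffineMap.lineMap_apply_module, smul_add, smul_smul, smul_smul, inv_mul_cancel₀ htne,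
        one_smul, ← add_assoc, ← add_smul]
      have : 1 - t⁻¹ + t⁻¹ * (1 - t) = 0 := by field_simp; ring
      rw [this, zero_smul, zero_add]
    rw [hx']
    have htpos : 0 < t := by linarith
    exact convex_convexHull ℝ _ h1 h2 (by rw [sub_nonneg]; exact inv_le_one_of_one_le₀ ht1.le)
      (by positivity) (by ring)

/-- A finite union of bounded convex polyhedra has a triangulation each of whose simplices lies in
one of them. -/
theorem exists_triangulation_subordinate {ι : Type*} [Finite ι] {P : ι → Set E}
    (hP : ∀ i, IsHPolyhedron (P i)) (hb : ∀ i, Bornology.IsBounded (P i)) :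
    ∃ L : Geometry.SimplicialComplex ℝ E, IsTriangulation L (⋃ i, P i) ∧
      ∀ s ∈ L.faces, ∃ i, convexHull ℝ (s : Set E) ⊆ P i := by
  classical
  cases nonempty_fintype ι
  choose S hS using hP
  let A : Finset (E →ᵃ[ℝ] ℝ) := Finset.univ.biUnion S
  let a : A → E →ᵃ[ℝ] ℝ := fun k => k.1
  let S' : ι → Finset A := fun i => Finset.univ.filter fun k => k.1 ∈ S i
  have hS' : ∀ i, P i = {x | ∀ k ∈ S' i, 0 ≤ a k x} := by
    intro i
    rw [hS i]
    ext x
    simp only [mem_ofPred_eq, S', a, Finset.mem_filter, Finset.mem_univ, true_and, Subtype.forall]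
    exact ⟨fun h k _ hk => h k hk, fun h k hk => h k (Finset.mem_biUnion.2 ⟨i, by simp, hk⟩) hk⟩
  let X : Set E := ⋃ i, P i
  let sv : E → A → SignType := fun x k => SignType.sign (a k x)
  have hsv : ∀ x y, sv x = sv y → CellLE a x y := by
    intro x y h k
    have hk : SignType.sign (a k x) = SignType.sign (a k y) := congrFun h k
    rcases lt_trichotomy (a k x) 0 with h1 | h1 | h1
    · rw [sign_neg h1] at hk
      exact .inr (mul_pos_of_neg_of_neg h1 (sign_eq_neg_one_iff.1 hk.symm))
    · exact .inl h1
    · rw [sign_pos h1] at hk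
      exact .inr (mul_pos h1 (sign_eq_one_iff.1 hk.symm))
  have hvs : ∀ x y, CellLE a x y → CellLE a y x → sv x = sv y := by
    intro x y h h'
    funext k
    simp only [sv]
    rcases h k with h1 | h1
    · have : a k y = 0 := by
        by_contra hne; exact h'.support_subset hne h1
      rw [h1, this]
    · rcases pos_and_pos_or_neg_and_neg_of_mul_pos h1 with ⟨h2, h3⟩ | ⟨h2, h3⟩
      · rw [sign_pos h2, sign_pos h3]
      · rw [sign_neg h2, sign_neg h3]
  -- One representative for each sign vector that occurs on `X`; finitely many, since `A → SignType`
  -- is finite.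
  obtain ⟨V0, hV0X, hbij⟩ := SurjOn.exists_bijOn_subset (surjOn_image sv X)
  have hV0 := hbij.image_eq
  have hV0inj := hbij.injOn
  have hfin : V0.Finite := Finite.of_finite_image (toFinite _) hV0inj
  lift V0 to Finset E using hfin
  have hV : ∀ u ∈ V0, ∀ v ∈ V0, CellLE a u v → CellLE a v u → u = v :=
    fun u hu v hv h h' => hV0inj hu hv (hvs u v h h')
  -- Weak inequalities in the `a k` define `P i`, so they persist on faces of cells.
  have hlow : ∀ i x y, CellLE a x y → y ∈ P i → x ∈ P i := by
    intro i x y h hy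
    rw [hS' i] at hy ⊢
    intro k hk
    have h1 := hy k hk
    rcases h k with h2 | h2
    · exact h2.ge
    · by_contra! hneg
      nlinarith
  have hface : ∀ s ∈ (chainComplex a V0 hV).faces, ∃ i, convexHull ℝ (s : Set E) ⊆ P i := by
    rintro s ⟨hne, hsV, hs⟩
    obtain ⟨u, hu, htop⟩ := exists_cellLE_top (a := a) s.finite_toSet hne hs
    obtain ⟨i, hi⟩ := mem_iUnion.1 (hV0X (hsV hu))
    refine ⟨i, convexHull_min (fun v hv => hlow i v u (htop v hv) hi) ?_⟩
    exact IsHPolyhedron.convex ⟨S i, hS i⟩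
  refine ⟨chainComplex a V0 hV, ⟨?_, ?_⟩, hface⟩
  · exact V0.powerset.finite_toSet.subset fun s hs => by simpa using hs.2.1
  · apply Subset.antisymm
    · intro x hx
      obtain ⟨s, hs, hxs⟩ := Geometry.SimplicialComplex.mem_space_iff.1 hx
      obtain ⟨i, hi⟩ := hface s hs
      exact mem_iUnion.2 ⟨i, hi hxs⟩
    · intro x hx
      obtain ⟨i, hi⟩ := mem_iUnion.1 hx
      obtain ⟨s, hne, hsV, hs, -, hxs⟩ := exists_chain_mem_convexHull (a := a) (V := V0) (hS' i)
        (hb i) (fun x hx => by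
          have : sv x ∈ sv '' V0 := by rw [hV0]; exact ⟨x, mem_iUnion.2 ⟨i, hx⟩, rfl⟩
          obtain ⟨b, hbV, hbx⟩ := this
          exact ⟨b, hbV, hlow i b x (hsv _ _ hbx) hx, hsv _ _ hbx, hsv _ _ hbx.symm⟩)
        _ x hi le_rfl
      exact Geometry.SimplicialComplex.mem_space_iff.2 ⟨s, ⟨hne, hsV, hs⟩, hxs⟩

/-- A piecewise affine map between compact polyhedra is a PL map. -/
theorem IsPiecewiseAffine.isPLMap {F : Type*} [NormedAddCommGroup F] [NormedSpace ℝ F]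
    [FiniteDimensional ℝ E] [FiniteDimensional ℝ F] {f : E → F} {X : Set E} {Y : Set F}
    (hf : IsPiecewiseAffine f X) (hX : Bornology.IsBounded X) (hXY : MapsTo f X Y)
    {K : Geometry.SimplicialComplex ℝ F} (hK : IsTriangulation K Y) : IsPLMap f X Y := by
  refine ⟨hf.continuousOn, ?_⟩
  obtain ⟨ι, _, P, g, hP, rfl, hg⟩ := hf
  have := hK.1.to_subtype
  -- Cutting by the preimages of the simplices of `K` makes each simplex of the resulting
  -- triangulation map into a single simplex of `K`.
  have hcover : (⋃ i, P i) = ⋃ p : ι × K.faces, P p.1 ∩ g p.1 ⁻¹' convexHull ℝ (p.2.1 : Set F) := by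
    ext x
    simp only [mem_iUnion, Prod.exists, mem_inter_iff, mem_preimage]
    refine ⟨fun ⟨i, hi⟩ => ?_, fun ⟨i, j, hi, _⟩ => ⟨i, hi⟩⟩
    have h1 := hXY (mem_iUnion.2 ⟨i, hi⟩)
    rw [← hK.2] at h1
    obtain ⟨t, ht, hxt⟩ := Geometry.SimplicialComplex.mem_space_iff.1 h1
    exact ⟨i, ⟨t, ht⟩, hi, by rwa [hg i hi] at hxt⟩
  obtain ⟨L, hL, hLP⟩ := exists_triangulation_subordinate
    (P := fun p : ι × K.faces => P p.1 ∩ g p.1 ⁻¹' convexHull ℝ (p.2.1 : Set F))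
    (fun p => (hP p.1).inter ((isHPolyhedron_convexHull (K.indep p.2.2)).preimage _))
    (fun p => hX.subset fun x hx => mem_iUnion.2 ⟨p.1, hx.1⟩)
  rw [← hcover] at hL
  refine ⟨L, K, hL, hK, fun s hs => ?_⟩
  obtain ⟨p, hp⟩ := hLP s hs
  have he : EqOn f (g p.1) (convexHull ℝ (s : Set E)) := fun x hx => hg p.1 (hp hx).1
  refine ⟨⟨g p.1, he⟩, p.2.1, p.2.2, ?_⟩
  rintro _ ⟨x, hx, rfl⟩
  rw [he hx]
  exact (hp hx).2

end Arrangement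

/-! ### Polyhedral complements of PL subspaces -/

section Complement

variable {E : Type*} [NormedAddCommGroup E] [NormedSpace ℝ E]

theorem IsPolyhedral.biUnion {κ : Type*} {T : Set κ} (hT : T.Finite) {P : κ → Set E}
    (h : ∀ i ∈ T, IsHPolyhedron (P i)) : IsPolyhedral (⋃ i ∈ T, P i) := by
  have := hT.to_subtype
  obtain ⟨e⟩ : Nonempty (Fin (Nat.card T) ≃ T) := ⟨(Finite.equivFin _).symm⟩
  refine ⟨Fin (Nat.card T), inferInstance, fun i => P (e i), fun i => h _ (e i).2, ?_⟩
  rw [biUnion_eq_iUnion, e.surjective.iUnion_comp (g := fun i : T => P i)]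

theorem isPolyhedral_Icc : IsPolyhedral (Icc (0 : ℝ) 1) := by
  refine IsHPolyhedron.isPolyhedral ?_
  convert! (isHPolyhedron_halfSpace (AffineMap.id ℝ ℝ)).inter
    (isHPolyhedron_halfSpace (AffineMap.const ℝ ℝ (1 : ℝ) - AffineMap.id ℝ ℝ)) using 1
  ext u
  simp

theorem IsPolyhedral.preimage {F : Type*} [NormedAddCommGroup F] [NormedSpace ℝ F] {Y : Set F}
    (hY : IsPolyhedral Y) (f : E →ᵃ[ℝ] F) : IsPolyhedral (f ⁻¹' Y) := by
  obtain ⟨ι, _, P, hP, rfl⟩ := hY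
  exact ⟨ι, inferInstance, fun i => f ⁻¹' P i, fun i => (hP i).preimage f, preimage_iUnion⟩

theorem subset_of_sum_mem_convexHull {s t : Finset E} (hs : AffineIndependent ℝ ((↑) : s → E))
    (hts : t ⊆ s) {u : E → ℝ} (hu : ∀ v ∈ s, 0 < u v) (hu1 : ∑ v ∈ s, u v = 1)
    (h : ∑ v ∈ s, u v • v ∈ convexHull ℝ (t : Set E)) : s ⊆ t := by
  classical
  rw [affineIndependent_finset_iff] at hs
  obtain ⟨w, -, hw1, hw⟩ := Finset.mem_convexHull'.1 h
  let w' : E → ℝ := fun v => if v ∈ t then w v else 0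
  have h1 : ∑ v ∈ s, w' v = 1 := by
    simp only [w']; rw [Finset.sum_ite_mem, Finset.inter_eq_right.2 hts, hw1]
  have h2 : ∑ v ∈ s, w' v • v = ∑ v ∈ s, u v • v := by
    simp only [w', ite_smul, zero_smul]; rw [Finset.sum_ite_mem, Finset.inter_eq_right.2 hts, hw]
  intro v hv
  by_contra hvt
  have := hs (fun v => u v - w' v) (by rw [Finset.sum_sub_distrib, hu1, h1, sub_self])
    (by simp only [sub_smul]; rw [Finset.sum_sub_distrib, h2, sub_self]) v hv
  simp only [w', if_neg hvt, sub_zero] at this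
  exact (hu v hv).ne' this

/-- The simplices not in a subcomplex lie in the closure of its complement. -/
theorem notMem_nhdsWithin_of_notMem_faces {L L' : Geometry.SimplicialComplex ℝ E} (hL : L' ≤ L)
    {s : Finset E} (hs : s ∈ L.faces) (hs' : s ∉ L'.faces) {x : E}
    (hx : x ∈ convexHull ℝ (s : Set E)) : L'.space ∉ 𝓝[L.space] x := by
  classical
  intro hB
  obtain ⟨w, hw0, hw1, hwx⟩ := Finset.mem_convexHull'.1 hx
  have hne := L.nonempty_of_mem_faces hs
  have hn : (0 : ℝ) < s.card := by exact_mod_cast hne.card_pos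
  -- Slide `x` towards the barycentre of `s`: for small `δ > 0` the point is interior to `s`, so a
  -- simplex of `L'` containing it would have `s` as a face.
  let p : ℝ → E := fun δ => ∑ v ∈ s, ((1 - δ) * w v + δ * (1 / s.card)) • v
  have hpc : Continuous p := by fun_prop
  have hp0 : p 0 = x := by simp [p, hwx]
  have hsum : ∀ δ, ∑ v ∈ s, ((1 - δ) * w v + δ * (1 / s.card)) = 1 := by
    intro δ
    rw [Finset.sum_add_distrib, ← Finset.mul_sum, ← Finset.mul_sum, hw1]
    simp [hn.ne']
  have hpos : ∀ δ ∈ Ioo (0 : ℝ) 1, ∀ v ∈ s, 0 < (1 - δ) * w v + δ * (1 / s.card) := by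
    intro δ hδ v hv
    have h1 : 0 ≤ (1 - δ) * w v := mul_nonneg (by linarith [hδ.2]) (hw0 v hv)
    have h2 : 0 < δ * (1 / s.card) := mul_pos hδ.1 (by positivity)
    linarith
  have hps : ∀ δ ∈ Ioo (0 : ℝ) 1, p δ ∈ convexHull ℝ (s : Set E) := fun δ hδ =>
    Finset.mem_convexHull'.2 ⟨_, fun v hv => (hpos δ hδ v hv).le, hsum δ, rfl⟩
  have hev : ∀ᶠ δ in 𝓝[>] (0 : ℝ), δ ∈ Ioo (0 : ℝ) 1 := Ioo_mem_nhdsGT one_pos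
  have htend : Filter.Tendsto p (𝓝[>] 0) (𝓝[L.space] x) := by
    refine tendsto_nhdsWithin_iff.2 ⟨?_, ?_⟩
    · rw [← hp0]
      exact hpc.continuousAt.tendsto.mono_left nhdsWithin_le_nhds
    · filter_upwards [hev] with δ hδ
      exact Geometry.SimplicialComplex.convexHull_subset_space hs (hps δ hδ)
  obtain ⟨δ, hδB, hδ⟩ := ((htend.eventually_mem hB).and hev).exists
  obtain ⟨s', hs'L, hδs'⟩ := Geometry.SimplicialComplex.mem_space_iff.1 hδB
  have hmem := L.inter_subset_convexHull hs (hL hs'L) ⟨hps δ hδ, hδs'⟩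
  rw [← Finset.coe_inter] at hmem
  have hsub := subset_of_sum_mem_convexHull (L.indep hs) Finset.inter_subset_left
    (hpos δ hδ) (hsum δ) hmem
  exact hs' (L'.down_closed hs'L (hsub.trans Finset.inter_subset_right) hne)

/-- `C` is the union of the simplices outside the subcomplex. A move defined on `B` extends over `C`
by the identity, and the last clause keeps `C` away from the support of the move. -/
theorem IsPLSubspace.exists_complement [FiniteDimensional ℝ E] {B M : Set E}
    (h : IsPLSubspace B M) :
    ∃ C : Set E, IsPolyhedral C ∧ B ∪ C = M ∧ ∀ x ∈ C, B ∉ 𝓝[M] x := by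
  obtain ⟨L, L', hL, hLL', rfl⟩ := h
  refine ⟨⋃ s ∈ L.faces \ L'.faces, convexHull ℝ (s : Set E),
    .biUnion (hL.1.subset sdiff_subset) fun s hs => isHPolyhedron_convexHull (L.indep hs.1), ?_, ?_⟩
  · rw [← hL.2]
    ext x
    simp only [mem_union, Geometry.SimplicialComplex.mem_space_iff, mem_iUnion, Set.mem_sdiff,
      exists_prop]
    constructor
    · rintro (⟨s, hs, hx⟩ | ⟨s, hs, hx⟩)
      exacts [⟨s, hLL' hs, hx⟩, ⟨s, hs.1, hx⟩]
    · rintro ⟨s, hs, hx⟩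
      by_cases h : s ∈ L'.faces
      exacts [.inl ⟨s, h, hx⟩, .inr ⟨s, ⟨hs, h⟩, hx⟩]
  · intro x hx
    obtain ⟨s, hs, hxs⟩ := mem_iUnion₂.1 hx
    rw [← hL.2]
    exact notMem_nhdsWithin_of_notMem_faces hLL' hs.1 hs.2 hxs

end Complement

/-! ### Charts and the local moves -/

section Charts

variable {E : Type*} [NormedAddCommGroup E] [NormedSpace ℝ E]

/-- Inclusion of `ℝᵐ` in `ℝᵐ⁺¹` onto the hyperplane of points whose coordinates have sum one. -/
noncomputable def baryEmbedding (m : ℕ) : (Fin m → ℝ) →ᵃ[ℝ] (Fin (m + 1) → ℝ) :=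
  (LinearMap.pi (Fin.cons (α := fun _ => (Fin m → ℝ) →ₗ[ℝ] ℝ) (-∑ i, LinearMap.proj i)
    LinearMap.proj) : (Fin m → ℝ) →ₗ[ℝ] (Fin (m + 1) → ℝ)).toAffineMap +
    AffineMap.const ℝ (Fin m → ℝ) (Pi.single 0 1 : Fin (m + 1) → ℝ)

theorem baryEmbedding_zero {m : ℕ} (y : Fin m → ℝ) : baryEmbedding m y 0 = 1 - ∑ i, y i := by
  simp [baryEmbedding]; ring

theorem baryEmbedding_succ {m : ℕ} (y : Fin m → ℝ) (i : Fin m) :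
    baryEmbedding m y i.succ = y i := by
  simp [baryEmbedding]

theorem mem_preimage_baryEmbedding {m : ℕ} {y : Fin m → ℝ} :
    y ∈ baryEmbedding m ⁻¹' stdSimplex ℝ (Fin (m + 1)) ↔ (∀ i, 0 ≤ y i) ∧ ∑ i, y i ≤ 1 := by
  rw [mem_preimage, stdSimplex, mem_ofPred_eq, Fin.sum_univ_succ, Fin.forall_fin_succ]
  simp only [baryEmbedding_zero, baryEmbedding_succ]
  constructor
  · rintro ⟨⟨h0, h⟩, -⟩
    exact ⟨h, by linarith⟩
  · rintro ⟨h, h0⟩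
    exact ⟨⟨by linarith, h⟩, by ring⟩

theorem interior_preimage_baryEmbedding_nonempty (m : ℕ) :
    (interior (baryEmbedding m ⁻¹' stdSimplex ℝ (Fin (m + 1)))).Nonempty := by
  refine ⟨fun _ => 1 / (m + 1), ?_⟩
  have ho : IsOpen {y : Fin m → ℝ | (∀ i, 0 < y i) ∧ ∑ i, y i < 1} := by
    refine IsOpen.inter ?_ (isOpen_lt (f := fun y : Fin m → ℝ => ∑ i, y i)
      (by fun_prop) continuous_const)
    have : {y : Fin m → ℝ | ∀ i, 0 < y i} = ⋂ i, {y | 0 < y i} := by ext; simp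
    change IsOpen {y : Fin m → ℝ | ∀ i, 0 < y i}
    rw [this]
    exact isOpen_iInter_of_finite fun i => isOpen_lt continuous_const (continuous_apply i)
  refine mem_interior.2 ⟨_, fun y hy => mem_preimage_baryEmbedding.2
    ⟨fun i => (hy.1 i).le, hy.2.le⟩, ho, fun i => by positivity, ?_⟩
  simp only [Finset.sum_const, Finset.card_univ, Fintype.card_fin, nsmul_eq_mul]
  rw [mul_one_div, div_lt_one (by positivity)]
  linarith

/-- Forgetting the zeroth barycentric coordinate turns the standard simplex into a convex set with
interior in `ℝᵐ`, so that displacements form an open set of full dimension `m`. -/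
theorem IsPLHomeo.exists_euclidean_chart [FiniteDimensional ℝ E] {m : ℕ} {B : Set E}
    {f : E → (Fin (m + 1) → ℝ)} (hf : IsPLHomeo f B (stdSimplex ℝ (Fin (m + 1)))) :
    ∃ (D : Set (Fin m → ℝ)) (f' : E → (Fin m → ℝ)) (g' : (Fin m → ℝ) → E),
      Convex ℝ D ∧ (interior D).Nonempty ∧ IsPiecewiseAffine f' B ∧ IsPiecewiseAffine g' D ∧
      MapsTo f' B D ∧ MapsTo g' D B ∧ InvOn g' f' B D := by
  obtain ⟨hpl, g, -, hg, hgf⟩ := hf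
  have hfm := hpl.mapsTo
  have hgPA := hpl.isPiecewiseAffine_inv hg hgf
  have hemb : ∀ y ∈ stdSimplex ℝ (Fin (m + 1)), baryEmbedding m (fun i => y i.succ) = y := by
    intro y hy
    have h1 := hy.2
    rw [Fin.sum_univ_succ] at h1
    funext i
    refine Fin.cases ?_ (fun i => ?_) i
    · rw [baryEmbedding_zero]; linarith
    · rw [baryEmbedding_succ]
  refine ⟨baryEmbedding m ⁻¹' stdSimplex ℝ (Fin (m + 1)), fun x i => f x i.succ,
    fun y => g (baryEmbedding m y), (convex_stdSimplex ℝ _).affine_preimage _,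
    interior_preimage_baryEmbedding_nonempty m, ?_, ?_, ?_, ?_, ?_, ?_⟩
  · exact hpl.isPiecewiseAffine.affine_comp (LinearMap.funLeft ℝ ℝ Fin.succ).toAffineMap
  · exact hgPA.comp_affine (hgPA.isPolyhedral.preimage _) _ fun y hy => hy
  · intro x hx
    rw [mem_preimage, hemb _ (hfm hx)]
    exact hfm hx
  · exact fun y hy => hg hy
  · intro x hx
    simp only
    rw [hemb _ (hfm hx), hgf.1 hx]
  · intro y hy
    funext i
    simp only
    rw [hgf.2 hy, baryEmbedding_succ]

/-- An open family of homotopies of `M` supported in `S`; the parameter is recovered, in a countably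
Lipschitz way, from a point, the time, and the value of the homotopy. -/
structure HasMoves (m : ℕ) (M S : Set E) (V : Set (Fin m → ℝ)) (H : (Fin m → ℝ) → E × ℝ → E)
    (B : Set E) (h : E × ℝ × E → (Fin m → ℝ)) : Prop where
  isOpen : IsOpen V
  nonempty : V.Nonempty
  piecewiseAffine : ∀ v ∈ V, IsPiecewiseAffine (H v) (M ×ˢ Icc (0 : ℝ) 1)
  mapsTo : ∀ v ∈ V, MapsTo (H v) (M ×ˢ Icc (0 : ℝ) 1) M
  zero : ∀ v ∈ V, ∀ x ∈ M, H v (x, 0) = x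
  off : ∀ v ∈ V, ∀ x ∈ M, x ∉ S → ∀ u, H v (x, u) = x
  injOn : ∀ v ∈ V, ∀ u ∈ Icc (0 : ℝ) 1, InjOn (fun x => H v (x, u)) M
  lipschitz : CountablyLipschitzOn h {p | p.1 ∈ S ∧ p.2.1 ∈ Ioc (0 : ℝ) 1 ∧ p.2.2 ∈ B}
  param : ∀ v ∈ V, ∀ x ∈ S, ∀ u ∈ Ioc (0 : ℝ) 1, H v (x, u) ∈ B ∧ h (x, u, H v (x, u)) = v

/-- The `ℓ¹` distance to `y₀`. -/
def lOneDist {m : ℕ} (y₀ y : Fin m → ℝ) : ℝ := ∑ i, |y i - y₀ i|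

theorem dist_le_lOneDist {m : ℕ} (y₀ y : Fin m → ℝ) : dist y y₀ ≤ lOneDist y₀ y := by
  refine (dist_pi_le_iff (Finset.sum_nonneg fun _ _ => abs_nonneg _)).2 fun i => ?_
  rw [Real.dist_eq]
  exact Finset.single_le_sum (f := fun i => |y i - y₀ i|) (fun _ _ => abs_nonneg _)
    (Finset.mem_univ i)

theorem abs_lOneDist_sub_le {m : ℕ} (y₀ y z : Fin m → ℝ) :
    |lOneDist y₀ y - lOneDist y₀ z| ≤ m * ‖y - z‖ := by
  rw [lOneDist, lOneDist, ← Finset.sum_sub_distrib]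
  refine (Finset.abs_sum_le_sum_abs _ _).trans ?_
  refine (Finset.sum_le_card_nsmul _ _ ‖y - z‖ fun i _ => ?_).trans (by simp)
  refine (abs_abs_sub_abs_le_abs_sub _ _).trans ?_
  rw [sub_sub_sub_cancel_right]
  exact norm_le_pi_norm (y - z) i

theorem isPiecewiseAffine_lOneDist {m : ℕ} (y₀ : Fin m → ℝ) :
    IsPiecewiseAffine (lOneDist y₀) univ := by
  have hu := (isHPolyhedron_univ (E := Fin m → ℝ)).isPolyhedral
  refine IsPiecewiseAffine.sum _ hu fun i _ => IsPiecewiseAffine.abs ?_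
  exact (hu.piecewiseAffine (LinearMap.proj i).toAffineMap).sub (hu.const (y₀ i))

/-- The size of the displacement at time `u`: a multiple of `u`, cut off away from `y₀`. -/
noncomputable def bump {m : ℕ} (ε r : ℝ) (y₀ : Fin m → ℝ) (p : (Fin m → ℝ) × ℝ) : ℝ :=
  ε * max 0 (min p.2 (r - lOneDist y₀ p.1))

section Bump

variable {m : ℕ} {ε r : ℝ} {y₀ y z : Fin m → ℝ} {u : ℝ}

theorem isPiecewiseAffine_bump : IsPiecewiseAffine (bump ε r y₀) univ := by
  have hu := (isHPolyhedron_univ (E := (Fin m → ℝ) × ℝ)).isPolyhedral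
  refine IsPiecewiseAffine.const_mul ((hu.const (0 : ℝ)).max ?_) ε
  refine (hu.piecewiseAffine AffineMap.snd).min ((hu.const r).sub ?_)
  exact (isPiecewiseAffine_lOneDist y₀).comp (hu.piecewiseAffine AffineMap.fst) (mapsTo_univ _ _)

theorem bump_eq_zero_of_le (h : r ≤ lOneDist y₀ y) : bump ε r y₀ (y, u) = 0 := by
  rw [bump, max_eq_left, mul_zero]
  exact (min_le_right _ _).trans (by simpa using h)

theorem bump_zero : bump ε r y₀ (y, 0) = 0 := by
  rw [bump, max_eq_left, mul_zero]
  exact min_le_left _ _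

theorem bump_nonneg (hε : 0 ≤ ε) : 0 ≤ bump ε r y₀ (y, u) :=
  mul_nonneg hε (le_max_left _ _)

theorem bump_le_one (hε1 : ε ≤ 1) (hu : u ≤ 1) : bump ε r y₀ (y, u) ≤ 1 :=
  mul_le_one₀ hε1 (le_max_left _ _) (max_le zero_le_one ((min_le_left _ _).trans hu))

theorem bump_pos (hε : 0 < ε) (hu : 0 < u) (h : lOneDist y₀ y < r) : 0 < bump ε r y₀ (y, u) :=
  mul_pos hε (lt_max_of_lt_right (lt_min hu (by simpa using h)))

theorem abs_bump_sub_le (hε : 0 ≤ ε) :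
    |bump ε r y₀ (y, u) - bump ε r y₀ (z, u)| ≤ ε * (m * ‖y - z‖) := by
  rw [bump, bump, ← mul_sub, abs_mul, abs_of_nonneg hε]
  refine mul_le_mul_of_nonneg_left ?_ hε
  refine (abs_max_sub_max_le_max _ _ _ _).trans (max_le (by simp; positivity) ?_)
  refine (abs_min_sub_min_le_max _ _ _ _).trans (max_le (by simp; positivity) ?_)
  rw [sub_sub_sub_cancel_left, abs_sub_comm]
  exact abs_lOneDist_sub_le _ _ _

/-- The displacement is Lipschitz in `y` with constant `ε * m * ‖v‖ < 1`, and the identity plus a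
contraction is injective. -/
theorem eq_of_add_bump_smul_eq {v : Fin m → ℝ} (hε : 0 ≤ ε) (hv : ε * (m * ‖v‖) < 1)
    (h : y + bump ε r y₀ (y, u) • v = z + bump ε r y₀ (z, u) • v) : y = z := by
  have h1 : y - z = (bump ε r y₀ (z, u) - bump ε r y₀ (y, u)) • v := by
    rw [sub_smul, sub_eq_sub_iff_add_eq_add, h, add_comm]
  have h2 : ‖y - z‖ ≤ ε * (m * ‖y - z‖) * ‖v‖ := by
    conv_lhs => rw [h1]
    rw [norm_smul, Real.norm_eq_abs, abs_sub_comm]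
    exact mul_le_mul_of_nonneg_right (abs_bump_sub_le hε) (norm_nonneg _)
  by_contra hne
  have h3 : 0 < ‖y - z‖ := norm_pos_iff.2 (sub_ne_zero.2 hne)
  nlinarith

end Bump

theorem countablyLipschitzOn_inv_smul (m : ℕ) :
    CountablyLipschitzOn (fun q : ℝ × (Fin m → ℝ) => q.1⁻¹ • q.2) {q | 0 < q.1} := by
  refine ContDiffOn.countablyLipschitzOn (fun q hq => ?_)
    (isOpen_lt continuous_const continuous_fst)
  have h1 : ContDiffAt ℝ 1 (fun q : ℝ × (Fin m → ℝ) => q.1⁻¹) q :=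
    contDiffAt_fst.inv (ne_of_gt hq)
  exact (h1.smul contDiffAt_snd).contDiffWithinAt

-- `H v` is `y ↦ y + ρ • v` in the chart and the identity elsewhere. As `y₀` may lie on the boundary
-- of `D`, `v` is taken near `c - y₀`: then `y + v` is close to `c`, and convexity keeps the path
-- from `y` towards `y + v` in `D`.
set_option maxHeartbeats 1000000 in
theorem exists_hasMoves_of_chart [FiniteDimensional ℝ E] {m : ℕ} {M B C : Set E}
    {D : Set (Fin m → ℝ)} {f : E → (Fin m → ℝ)} {g : (Fin m → ℝ) → E} (hBC : B ∪ C = M)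
    (hC : IsPolyhedral C) (hCB : ∀ x ∈ C, B ∉ 𝓝[M] x) (hD : Convex ℝ D)
    (hDi : (interior D).Nonempty) (hf : IsPiecewiseAffine f B) (hg : IsPiecewiseAffine g D)
    (hfm : MapsTo f B D) (hgm : MapsTo g D B) (hgf : InvOn g f B D) {x₀ : E} (hx₀ : x₀ ∈ M)
    (hB : B ∈ 𝓝[M] x₀) :
    ∃ S ∈ 𝓝[M] x₀, S ⊆ M ∧ ∃ V H B' h, HasMoves m M S V H B' h := by
  classical
  have hx₀B : x₀ ∈ B := mem_of_mem_nhdsWithin hx₀ hB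
  set y₀ := f x₀ with hy₀
  obtain ⟨c, hc⟩ := hDi
  obtain ⟨r₀, hr₀, hball⟩ := Metric.isOpen_iff.1 isOpen_interior c hc
  have hballD : Metric.ball c r₀ ⊆ D := hball.trans interior_subset
  obtain ⟨U, hUo, hx₀U, hUB⟩ := mem_nhdsWithin.1 hB
  have hgc : g ⁻¹' U ∈ 𝓝[D] y₀ := by
    refine (hg.continuousOn y₀ (hfm hx₀B)).preimage_mem_nhdsWithin ?_
    rw [hy₀, hgf.1 hx₀B]
    exact hUo.mem_nhds hx₀U
  obtain ⟨r₁, hr₁, hr₁U⟩ := Metric.mem_nhdsWithin_iff.1 hgc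
  -- The bound `r₁` puts the support inside `U`, hence off `C`. The bound `r₀ / 2` leaves the other
  -- half of `r₀` for the deviation of `v` from `c - y₀`.
  set r := min r₁ (r₀ / 2) with hr
  have hrpos : 0 < r := lt_min hr₁ (by linarith)
  -- `R` bounds `‖v‖` on `V`, and `ε` is chosen so that `ε * m * R < 1`, as injectivity requires.
  set R := ‖c - y₀‖ + r₀ / 2 with hR
  have hRpos : 0 < R := by positivity
  set ε : ℝ := 1 / (m * R + 1) with hε
  have hεpos : 0 < ε := by rw [hε]; positivity
  have hε1 : ε ≤ 1 := by
    rw [hε, div_le_one (by positivity)]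
    have : 0 ≤ m * R := by positivity
    linarith
  let V : Set (Fin m → ℝ) := Metric.ball (c - y₀) (r₀ / 2)
  have hVR : ∀ v ∈ V, ε * (m * ‖v‖) < 1 := by
    intro v hv
    have h1 : ‖v‖ ≤ R := by
      have h2 : ‖v - (c - y₀)‖ < r₀ / 2 := by simpa [V, dist_eq_norm] using hv
      have h3 := norm_add_le (c - y₀) (v - (c - y₀))
      rw [add_sub_cancel] at h3
      linarith
    have h2 : (m : ℝ) * ‖v‖ ≤ m * R := by gcongr
    rw [hε, one_div_mul_eq_div, div_lt_one (by positivity)]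
    linarith
  let ρ := bump ε r y₀
  let S : Set E := {x ∈ B | lOneDist y₀ (f x) < r}
  let H (v : Fin m → ℝ) (p : E × ℝ) : E := if p.1 ∈ S then g (f p.1 + ρ (f p.1, p.2) • v) else p.1
  have hSB : S ⊆ B := sep_subset _ _
  have hBM : B ⊆ M := hBC ▸ subset_union_left
  have hSC : ∀ x ∈ S, x ∉ C := by
    intro x hx hxC
    refine hCB x hxC (mem_nhdsWithin.2 ⟨U, hUo, ?_, hUB⟩)
    have h1 : f x ∈ Metric.ball y₀ r₁ ∩ D := by
      refine ⟨?_, hfm hx.1⟩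
      exact (dist_le_lOneDist y₀ (f x)).trans_lt (hx.2.trans_le (min_le_left _ _))
    have h2 := hr₁U h1
    rwa [mem_preimage, hgf.1 hx.1] at h2
  -- The bump vanishes on `B` outside `S`, so a single formula describes the move on all of `B`.
  have hHB : ∀ v, ∀ x ∈ B, ∀ u, H v (x, u) = g (f x + ρ (f x, u) • v) := by
    intro v x hx u
    by_cases h : x ∈ S
    · simp only [H, if_pos h]
    · simp only [H, if_neg h]
      have : ρ (f x, u) = 0 := bump_eq_zero_of_le (not_lt.1 fun hlt => h ⟨hx, hlt⟩)
      rw [this, zero_smul, add_zero, hgf.1 hx]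
  have hHoff : ∀ v, ∀ x, x ∉ S → ∀ u, H v (x, u) = x := fun v x hx u => by
    simp only [H, if_neg hx]
  have hDmove : ∀ v ∈ V, ∀ y ∈ D, ∀ u ≤ (1 : ℝ), y + ρ (y, u) • v ∈ D := by
    intro v hv y hy u hu
    rcases le_or_gt r (lOneDist y₀ y) with h | h
    · have : ρ (y, u) = 0 := bump_eq_zero_of_le h
      rwa [this, zero_smul, add_zero]
    · have h1 : ‖y - y₀‖ < r₀ / 2 := by
        rw [← dist_eq_norm]
        exact (dist_le_lOneDist y₀ y).trans_lt (h.trans_le (min_le_right _ _))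
      have h2 : ‖v - (c - y₀)‖ < r₀ / 2 := by simpa [V, dist_eq_norm] using hv
      have h3 : y + v ∈ D := by
        apply hballD
        rw [Metric.mem_ball, dist_eq_norm]
        have : y + v - c = (y - y₀) + (v - (c - y₀)) := by abel
        rw [this]
        linarith [norm_add_le (y - y₀) (v - (c - y₀))]
      have h4 : y + ρ (y, u) • v = (1 - ρ (y, u)) • y + ρ (y, u) • (y + v) := by
        rw [smul_add, sub_smul, one_smul]; abel
      rw [h4]
      exact hD hy h3 (sub_nonneg.2 (bump_le_one hε1 hu)) (bump_nonneg hεpos.le) (by ring)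
  have hI := isPolyhedral_Icc
  have hBpoly := hf.isPolyhedral
  refine ⟨S, ?_, hSB.trans hBM, V, H, B, fun p => (ρ (f p.1, p.2.1))⁻¹ • (f p.2.2 - f p.1),
    Metric.isOpen_ball, ⟨c - y₀, Metric.mem_ball_self (by linarith)⟩, ?_, ?_, ?_, ?_, ?_, ?_, ?_⟩
  · have h1 : ContinuousWithinAt (fun x => lOneDist y₀ (f x)) B x₀ :=
      ((isPiecewiseAffine_lOneDist y₀).continuousOn.comp hf.continuousOn (mapsTo_univ _ _)) x₀ hx₀B
    have h2 : (fun x => lOneDist y₀ (f x)) ⁻¹' Iio r ∈ 𝓝[B] x₀ := by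
      refine h1.preimage_mem_nhdsWithin (Iio_mem_nhds ?_)
      simpa [lOneDist, ← hy₀] using hrpos
    exact Filter.inter_mem hB (nhdsWithin_le_of_mem hB h2)
  · intro v hv
    rw [← hBC, union_prod]
    refine IsPiecewiseAffine.union ?_ ?_
    · have hfst : IsPiecewiseAffine (fun p : E × ℝ => f p.1) (B ×ˢ Icc (0 : ℝ) 1) :=
        hf.comp_affine (hBpoly.prod hI) AffineMap.fst fun p hp => hp.1
      have hsnd : IsPiecewiseAffine (fun p : E × ℝ => p.2) (B ×ˢ Icc (0 : ℝ) 1) :=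
        (hBpoly.prod hI).piecewiseAffine AffineMap.snd
      have hρ : IsPiecewiseAffine (fun p : E × ℝ => ρ (f p.1, p.2)) (B ×ˢ Icc (0 : ℝ) 1) :=
        isPiecewiseAffine_bump.comp (hfst.prodMk hsnd) (mapsTo_univ _ _)
      refine (hg.comp (hfst.add (hρ.smul_const v)) fun p hp => ?_).congr fun p hp => ?_
      · exact hDmove v hv _ (hfm hp.1) _ hp.2.2
      · exact hHB v p.1 hp.1 p.2
    · refine ((hC.prod hI).piecewiseAffine AffineMap.fst).congr fun p hp => ?_
      exact hHoff v p.1 (fun h => hSC _ h hp.1) p.2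
  · rintro v hv ⟨x, u⟩ ⟨hx, hu⟩
    by_cases h : x ∈ S
    · rw [hHB v x (hSB h)]
      exact hBM (hgm (hDmove v hv _ (hfm (hSB h)) _ hu.2))
    · rw [hHoff v x h]; exact hx
  · intro v _ x _
    by_cases h : x ∈ S
    · rw [hHB v x (hSB h), show ρ (f x, 0) = 0 from bump_zero, zero_smul, add_zero,
        hgf.1 (hSB h)]
    · exact hHoff v x h 0
  · exact fun v _ x _ hx u => hHoff v x hx u
  · intro v hv u hu
    have hmemB : ∀ x ∈ B, H v (x, u) ∈ B := fun x hx => by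
      rw [hHB v x hx]; exact hgm (hDmove v hv _ (hfm hx) _ hu.2)
    have hmix : ∀ x ∈ B, ∀ x', x' ∉ B → H v (x, u) ≠ H v (x', u) := by
      intro x hx x' hx' h
      rw [hHoff v x' (fun h => hx' (hSB h)) u] at h
      exact hx' (h ▸ hmemB x hx)
    intro x _ x' _ h
    simp only at h
    by_cases hxB : x ∈ B <;> by_cases hxB' : x' ∈ B
    · rw [hHB v x hxB, hHB v x' hxB'] at h
      have h1 := hgf.2.injOn (hDmove v hv _ (hfm hxB) _ hu.2) (hDmove v hv _ (hfm hxB') _ hu.2) h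
      exact hgf.1.injOn hxB hxB' (eq_of_add_bump_smul_eq hεpos.le (hVR v hv) h1)
    · exact absurd h (hmix x hxB x' hxB')
    · exact absurd h.symm (hmix x' hxB' x hxB)
    · rwa [hHoff v x (fun h => hxB (hSB h)), hHoff v x' (fun h => hxB' (hSB h))] at h
  · have hpoly : IsPolyhedral (B ×ˢ (Icc (0 : ℝ) 1 ×ˢ B)) := hBpoly.prod (hI.prod hBpoly)
    have h1 : IsPiecewiseAffine (fun p : E × ℝ × E => f p.1) (B ×ˢ (Icc (0 : ℝ) 1 ×ˢ B)) :=
      hf.comp_affine hpoly AffineMap.fst fun p hp => hp.1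
    have h2 : IsPiecewiseAffine (fun p : E × ℝ × E => p.2.1) (B ×ˢ (Icc (0 : ℝ) 1 ×ˢ B)) :=
      hpoly.piecewiseAffine
        ((AffineMap.fst : ℝ × E →ᵃ[ℝ] ℝ).comp (AffineMap.snd : E × ℝ × E →ᵃ[ℝ] ℝ × E))
    have h3 : IsPiecewiseAffine (fun p : E × ℝ × E => f p.2.2) (B ×ˢ (Icc (0 : ℝ) 1 ×ˢ B)) :=
      hf.comp_affine hpoly
        ((AffineMap.snd : ℝ × E →ᵃ[ℝ] E).comp (AffineMap.snd : E × ℝ × E →ᵃ[ℝ] ℝ × E))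
        fun p hp => hp.2.2
    have h4 : IsPiecewiseAffine (fun p : E × ℝ × E => (ρ (f p.1, p.2.1), f p.2.2 - f p.1))
        (B ×ˢ (Icc (0 : ℝ) 1 ×ˢ B)) :=
      (isPiecewiseAffine_bump.comp (h1.prodMk h2) (mapsTo_univ _ _)).prodMk (h3.sub h1)
    refine (countablyLipschitzOn_inv_smul m).comp (h4.countablyLipschitzOn.mono ?_) ?_
    · exact fun p hp => ⟨hSB hp.1, ⟨hp.2.1.1.le, hp.2.1.2⟩, hp.2.2⟩
    · exact fun p hp => bump_pos hεpos hp.2.1.1 hp.1.2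
  · intro v hv x hx u hu
    have hmem := hDmove v hv _ (hfm (hSB hx)) u hu.2
    rw [hHB v x (hSB hx)]
    refine ⟨hgm hmem, ?_⟩
    have hpos : 0 < ρ (f x, u) := bump_pos hεpos hu.1 hx.2
    simp only
    rw [hgf.2 hmem, add_sub_cancel_left, smul_smul, inv_mul_cancel₀ hpos.ne', one_smul]

theorem IsCompactPLManifold.exists_hasMoves [FiniteDimensional ℝ E] {m : ℕ} {M : Set E}
    (hM : IsCompactPLManifold m M) {x : E} (hx : x ∈ M) :
    ∃ S ∈ 𝓝[M] x, S ⊆ M ∧ ∃ V H B' h, HasMoves m M S V H B' h := by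
  obtain ⟨B, hBM, hB, f, hf⟩ := hM.2 x hx
  obtain ⟨C, hC, hBC, hCB⟩ := hBM.exists_complement
  obtain ⟨D, f', g', hD, hDi, hf', hg', hfm, hgm, hgf⟩ := hf.exists_euclidean_chart
  exact exists_hasMoves_of_chart hBC hC hCB hD hDi hf' hg' hfm hgm hgf hx hB

end Charts

/-! ### Comparing polyhedral and Hausdorff dimension -/

section Dimension

variable {E F : Type*} [NormedAddCommGroup E] [NormedSpace ℝ E]
  [NormedAddCommGroup F] [NormedSpace ℝ F]

theorem le_dim_of_finset {s : Finset E} (hs : AffineIndependent ℝ ((↑) : s → E)) {k : ℕ}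
    (hk : s.card = k + 1) {A : Set E} (hA : convexHull ℝ (s : Set E) ⊆ A) :
    ((k : ℝ) : EReal) ≤ dim A := by
  let e : Fin (k + 1) ≃ s := (s.equivFinOfCardEq hk).symm
  refine le_iSup₂_of_le (f := fun (k : ℕ) (_ : ∃ p : Fin (k + 1) → E, AffineIndependent ℝ p ∧
    convexHull ℝ (range p) ⊆ A) => ((k : ℝ) : EReal)) k ⟨fun i => e i, ?_, ?_⟩ le_rfl
  · exact hs.comp_embedding e.toEmbedding
  · have : range (fun i => (e i : E)) = s := by
      have h := e.surjective.range_comp ((↑) : s → E)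
      simpa [Function.comp_def] using h
    rwa [this]

/-- A `k`-simplex has Hausdorff dimension `k`. Nonemptiness is offered separately because `dimH ∅ =
0` whereas `dim ∅ = -∞`. -/
theorem dim_le_of_forall_le_dimH [FiniteDimensional ℝ E] {A : Set E} {c : EReal}
    (h : A.Nonempty → ∀ k : ℕ, (k : ℝ≥0∞) ≤ dimH A → ((k : ℝ) : EReal) ≤ c) : dim A ≤ c := by
  refine iSup₂_le fun k ⟨p, hp, hpA⟩ => ?_
  have hne : (convexHull ℝ (range p)).Nonempty := (range_nonempty p).convexHull
  refine h (hne.mono hpA) k ((dimH_mono hpA).trans' ?_)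
  rw [Real.Convex.dimH_eq_finrank_vectorSpan (convex_convexHull ℝ _) hne, ← direction_affineSpan,
    affineSpan_convexHull, direction_affineSpan, hp.finrank_vectorSpan (n := k) (by simp)]

variable [FiniteDimensional ℝ E]

theorem _root_.Convex.exists_simplex {Q : Set E} (hQ : Convex ℝ Q) (hne : Q.Nonempty) :
    ∃ s : Finset E, AffineIndependent ℝ ((↑) : s → E) ∧
      s.card = Module.finrank ℝ (vectorSpan ℝ Q) + 1 ∧ convexHull ℝ (s : Set E) ⊆ Q := by
  obtain ⟨t, htQ, hspan, ht⟩ := exists_affineIndependent ℝ E Q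
  have hfin : t.Finite := finite_set_of_fin_dim_affineIndependent ℝ ht
  lift t to Finset E using hfin
  have htne : t.Nonempty := by
    rw [Finset.nonempty_iff_ne_empty]
    rintro rfl
    rw [Finset.coe_empty, AffineSubspace.span_empty] at hspan
    obtain ⟨x, hx⟩ := hne
    exact (AffineSubspace.notMem_bot ℝ E x) (hspan ▸ subset_affineSpan ℝ Q hx)
  refine ⟨t, ht, ?_, convexHull_min htQ hQ⟩
  have : Nonempty t := htne.to_subtype
  have h := ht.finrank_vectorSpan_add_one
  rw [Subtype.range_coe, ← direction_affineSpan] at h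
  rw [← direction_affineSpan, ← hspan]
  simpa using h.symm

theorem _root_.Convex.finrank_le_dim {Q : Set E} (hQ : Convex ℝ Q) (hne : Q.Nonempty) :
    ((Module.finrank ℝ (vectorSpan ℝ Q) : ℝ) : EReal) ≤ dim Q := by
  obtain ⟨s, hs, hk, hsQ⟩ := hQ.exists_simplex hne
  exact le_dim_of_finset hs hk hsQ

/-- One of the finitely many pieces of `Q` has the full dimension of `Q`, hence contains a simplex
of that dimension, which `f` maps affinely and injectively. This bounds the right-hand side of
general position from below. -/
theorem IsPiecewiseAffine.finrank_le_dim_image {f : E → F} {X Q : Set E}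
    (hf : IsPiecewiseAffine f X) (hQX : Q ⊆ X) (hQ : Convex ℝ Q) (hne : Q.Nonempty)
    (hinj : InjOn f Q) : ((Module.finrank ℝ (vectorSpan ℝ Q) : ℝ) : EReal) ≤ dim (f '' Q) := by
  classical
  obtain ⟨ι, _, P, g, hP, rfl, hg⟩ := hf
  let J := {i : ι // (P i ∩ Q).Nonempty}
  have hcov : Q = ⋃ i : J, P i ∩ Q := by
    ext x
    simp only [mem_iUnion, mem_inter_iff, exists_and_right, iff_and_self]
    intro hx
    obtain ⟨i, hi⟩ := mem_iUnion.1 (hQX hx)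
    exact ⟨⟨i, ⟨x, hi, hx⟩⟩, hi⟩
  have hJ : Nonempty J := by
    obtain ⟨x, hx⟩ := hne
    rw [hcov] at hx
    obtain ⟨i, -⟩ := mem_iUnion.1 hx
    exact ⟨i⟩
  have hdim : dimH Q = ⨆ i : J, dimH (P i ∩ Q) := by
    conv_lhs => rw [hcov]
    exact dimH_iUnion _
  obtain ⟨i, hi⟩ := exists_eq_ciSup_of_finite (f := fun i : J => dimH (P i ∩ Q))
  have hconv : Convex ℝ (P i ∩ Q) := (hP i).convex.inter hQ
  rw [← hdim, Real.Convex.dimH_eq_finrank_vectorSpan hQ hne,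
    Real.Convex.dimH_eq_finrank_vectorSpan hconv i.2] at hi
  obtain ⟨s, hs, hk, hsQ⟩ := hconv.exists_simplex i.2
  have he : EqOn f (g i) (convexHull ℝ (s : Set E)) := fun x hx => hg i (hsQ hx).1
  have hinj' : InjOn (g i) (convexHull ℝ (s : Set E)) :=
    he.injOn_iff.1 (hinj.mono fun x hx => (hsQ hx).2)
  refine le_dim_of_finset (affineIndependent_image_of_injOn hs hinj') (A := f '' Q) ?_ ?_
  · rw [Finset.card_image_of_injOn (hinj'.mono (subset_convexHull ℝ _)), hk]
    congr 1
    exact_mod_cast hi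
  · rw [Finset.coe_image, ← AffineMap.image_convexHull, ← he.image_eq]
    exact image_mono fun x hx => (hsQ hx).2

end Dimension

/-! ### Generic composition of the moves -/

section Moves

variable {E : Type*} [NormedAddCommGroup E] [NormedSpace ℝ E] {m : ℕ} {M S B : Set E}
  {V : Set (Fin m → ℝ)} {H : (Fin m → ℝ) → E × ℝ → E} {h : E × ℝ × E → (Fin m → ℝ)}

/-- A pair `(a, c)` for which the moved point is `ψ c` lies in the fibre over `v` of a countably
Lipschitz map from a subset of `Q × T` to `ℝᵐ`; the intersection is the image of that fibre under
`ψ`. Leaving `q` general covers both the whole track, with the time as a coordinate of `Q`, and the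
final stage. -/
theorem HasMoves.ae_dimLESub (hH : HasMoves m M S V H B h) {Q T : Type*}
    [NormedAddCommGroup Q] [NormedSpace ℝ Q] [FiniteDimensional ℝ Q]
    [NormedAddCommGroup T] [NormedSpace ℝ T] [FiniteDimensional ℝ T]
    {φ : E × ℝ → E} (hφ : CountablyLipschitzOn φ (M ×ˢ Icc (0 : ℝ) 1))
    {A : Set Q} {q : Q → E × ℝ} (hq : CountablyLipschitzOn q A)
    (hqM : MapsTo q A (M ×ˢ Ioc (0 : ℝ) 1))
    {C : Set T} {ψ : T → E} (hψ : CountablyLipschitzOn ψ C) :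
    ∀ᵐ v : Fin m → ℝ, v ∈ V →
      DimLESub {w ∈ ψ '' C | ∃ a ∈ A, φ (q a) ∈ S ∧ H v (φ (q a), (q a).2) = w}
        (Module.finrank ℝ Q + Module.finrank ℝ T) m := by
  let X : Set (Q × T) := {p | (p.1 ∈ A ∧ φ (q p.1) ∈ S) ∧ p.2 ∈ C ∧ ψ p.2 ∈ B}
  have hI : Ioc (0 : ℝ) 1 ⊆ Icc 0 1 := Ioc_subset_Icc_self
  have hfst : CountablyLipschitzOn (fun p : Q × T => p.1) X :=
    LipschitzWith.prod_fst.countablyLipschitzOn X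
  have hsnd : CountablyLipschitzOn (fun p : Q × T => p.2) X :=
    LipschitzWith.prod_snd.countablyLipschitzOn X
  have hqX : CountablyLipschitzOn (fun p : Q × T => q p.1) X := hq.comp hfst fun p hp => hp.1.1
  have h1 : CountablyLipschitzOn (fun p : Q × T => φ (q p.1)) X :=
    hφ.comp hqX fun p hp => ⟨(hqM hp.1.1).1, hI (hqM hp.1.1).2⟩
  have h2 : CountablyLipschitzOn (fun p : Q × T => (q p.1).2) X :=
    (LipschitzWith.prod_snd.countablyLipschitzOn univ).comp hqX (mapsTo_univ _ _)
  have h3 : CountablyLipschitzOn (fun p : Q × T => ψ p.2) X := hψ.comp hsnd fun p hp => hp.2.1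
  have h4 : CountablyLipschitzOn (fun p : Q × T => h (φ (q p.1), (q p.1).2, ψ p.2)) X :=
    hH.lipschitz.comp (h1.prodMk (h2.prodMk h3)) fun p hp =>
      ⟨hp.1.2, (hqM hp.1.1).2, hp.2.2⟩
  filter_upwards [ae_dimLESub_fiber h4] with v hv hvV
  rw [Module.finrank_prod] at hv
  refine (hv.image (f := fun p : Q × T => ψ p.2) (h3.mono inter_subset_left)).mono ?_
  rintro _ ⟨⟨c, hc, rfl⟩, a, ha, haS, hw⟩
  obtain ⟨hB, hh⟩ := hH.param v hvV _ haS _ (hqM ha).2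
  rw [hw] at hB hh
  exact ⟨(a, c), ⟨⟨⟨ha, haS⟩, hc, hB⟩, hh⟩, rfl⟩

/-- `φ` is an injective PL homotopy of `M`, supported in `W`, such that the track of the part of
each simplex of `K` that lies in `W` has the expected intersections with the simplices of `K`. -/
structure IsGenericHomotopy (m : ℕ) (M : Set E) (K : Geometry.SimplicialComplex ℝ E) (W : Set E)
    (φ : E × ℝ → E) : Prop where
  piecewiseAffine : IsPiecewiseAffine φ (M ×ˢ Icc (0 : ℝ) 1)
  mapsTo : MapsTo φ (M ×ˢ Icc (0 : ℝ) 1) M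
  zero : ∀ x ∈ M, φ (x, 0) = x
  injOn : ∀ u ∈ Icc (0 : ℝ) 1, InjOn (fun x => φ (x, u)) M
  off : ∀ x ∈ M, x ∉ W → ∀ u, φ (x, u) = x
  track : ∀ s ∈ K.faces, ∀ t ∈ K.faces,
    DimLESub {w ∈ convexHull ℝ (t : Set E) | ∃ x ∈ convexHull ℝ (s : Set E),
        x ∈ W ∧ ∃ u ∈ Ioc (0 : ℝ) 1, φ (x, u) = w}
      (Module.finrank ℝ (vectorSpan ℝ (convexHull ℝ (s : Set E))) + 1 +
        Module.finrank ℝ (vectorSpan ℝ (convexHull ℝ (t : Set E)))) m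
  final : ∀ s ∈ K.faces, ∀ t ∈ K.faces,
    DimLESub {w ∈ convexHull ℝ (t : Set E) | ∃ x ∈ convexHull ℝ (s : Set E), x ∈ W ∧ φ (x, 1) = w}
      (Module.finrank ℝ (vectorSpan ℝ (convexHull ℝ (s : Set E))) +
        Module.finrank ℝ (vectorSpan ℝ (convexHull ℝ (t : Set E)))) m

variable {K : Geometry.SimplicialComplex ℝ E}

theorem isGenericHomotopy_fst (hM : IsPolyhedral M) :
    IsGenericHomotopy m M K ∅ (Prod.fst : E × ℝ → E) where
  piecewiseAffine := (hM.prod isPolyhedral_Icc).piecewiseAffine AffineMap.fst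
  mapsTo p hp := hp.1
  zero _ _ := rfl
  injOn _ _ _ _ _ _ h := h
  off _ _ _ _ := rfl
  track _ _ _ _ := by simpa using dimLESub_empty
  final _ _ _ _ := by simpa using dimLESub_empty

theorem lipschitzWith_add_coe (Z : Submodule ℝ E) (p : E) :
    LipschitzWith 1 (fun a : Z => p + (a : E)) :=
  LipschitzWith.of_dist_le_mul fun a b => by simp [Subtype.dist_eq]

/-- At each time `φ` is followed by `H v`. If `φ (x, u) ∈ S`, the choice of `v` gives the estimate.
If not, nothing changes and the estimate for `φ` applies, since `x ∈ W`: outside `W` one has `φ (x,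
u) = x`, and then `x ∈ S` would contradict `φ (x, u) ∉ S`. -/
theorem IsGenericHomotopy.exists_extend [FiniteDimensional ℝ E] (hK : IsTriangulation K M)
    {W : Set E} {φ : E × ℝ → E} (hφ : IsGenericHomotopy m M K W φ)
    (hH : HasMoves m M S V H B h) : ∃ φ', IsGenericHomotopy m M K (W ∪ S) φ' := by
  have hKM : ∀ s ∈ K.faces, convexHull ℝ (s : Set E) ⊆ M := fun s hs => by
    rw [← hK.2]; exact Geometry.SimplicialComplex.convexHull_subset_space hs
  have hφL := hφ.piecewiseAffine.countablyLipschitzOn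
  have hpt : ∀ s ∈ K.faces, ∃ p, p ∈ convexHull ℝ (s : Set E) := fun s hs =>
    (Finset.coe_nonempty.2 (K.nonempty_of_mem_faces hs)).convexHull
  choose! p hp using hpt
  -- Simplices are parametrised by their direction spaces, so that `finrank` counts their own
  -- dimension and not that of `E`.
  let Z (s : Finset E) : Submodule ℝ E := vectorSpan ℝ (convexHull ℝ (s : Set E))
  let C (s : Finset E) : Set (Z s) := {a | p s + (a : E) ∈ convexHull ℝ (s : Set E)}
  have hC : ∀ s ∈ K.faces, ∀ x ∈ convexHull ℝ (s : Set E), ∃ a ∈ C s, p s + (a : E) = x := by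
    intro s hs x hx
    have h1 : x - p s ∈ Z s := vsub_mem_vectorSpan ℝ hx (hp s hs)
    exact ⟨⟨x - p s, h1⟩, by simpa [C] using hx, by simp⟩
  have hψ : ∀ s, CountablyLipschitzOn (fun a : Z s => p s + (a : E)) (C s) := fun s =>
    (lipschitzWith_add_coe (Z s) (p s)).countablyLipschitzOn _
  have htrack : ∀ᵐ v : Fin m → ℝ, ∀ s ∈ K.faces, ∀ t ∈ K.faces, v ∈ V →
      DimLESub {w ∈ (fun a : Z t => p t + (a : E)) '' C t | ∃ a ∈ C s ×ˢ Ioc (0 : ℝ) 1,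
        φ (p s + (a.1 : E), a.2) ∈ S ∧ H v (φ (p s + (a.1 : E), a.2), a.2) = w}
        (Module.finrank ℝ (Z s) + 1 + Module.finrank ℝ (Z t)) m := by
    refine (ae_ball_iff hK.1.countable).2 fun s hs => (ae_ball_iff hK.1.countable).2 fun t ht => ?_
    have hq : CountablyLipschitzOn (fun a : Z s × ℝ => (p s + (a.1 : E), a.2))
        (C s ×ˢ Ioc (0 : ℝ) 1) :=
      ((hψ s).comp (LipschitzWith.prod_fst.countablyLipschitzOn _) fun a ha => ha.1).prodMk
        (LipschitzWith.prod_snd.countablyLipschitzOn _)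
    have := hH.ae_dimLESub hφL hq (fun a ha => ⟨hKM s hs ha.1, ha.2⟩) (hψ t)
    simpa only [Module.finrank_prod, Module.finrank_self] using this
  have hfinal : ∀ᵐ v : Fin m → ℝ, ∀ s ∈ K.faces, ∀ t ∈ K.faces, v ∈ V →
      DimLESub {w ∈ (fun a : Z t => p t + (a : E)) '' C t | ∃ a ∈ C s,
        φ (p s + (a : E), 1) ∈ S ∧ H v (φ (p s + (a : E), 1), 1) = w}
        (Module.finrank ℝ (Z s) + Module.finrank ℝ (Z t)) m := by
    refine (ae_ball_iff hK.1.countable).2 fun s hs => (ae_ball_iff hK.1.countable).2 fun t ht => ?_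
    have hq : CountablyLipschitzOn (fun a : Z s => (p s + (a : E), (1 : ℝ))) (C s) :=
      (hψ s).prodMk ((LipschitzWith.const (1 : ℝ)).countablyLipschitzOn _)
    exact hH.ae_dimLESub hφL hq (fun a ha => ⟨hKM s hs ha, by simp⟩) (hψ t)
  -- A set of full measure is dense, so it meets the nonempty open set `V`.
  obtain ⟨v, hvV, hv1, hv2⟩ :=
    (Measure.dense_of_ae (htrack.and hfinal)).inter_open_nonempty V hH.isOpen hH.nonempty
  have hmem : ∀ x ∈ M, ∀ u ∈ Icc (0 : ℝ) 1, φ (x, u) ∈ M := fun x hx u hu => hφ.mapsTo ⟨hx, hu⟩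
  refine ⟨fun p => H v (φ p, p.2), ?_, ?_, ?_, ?_, ?_, ?_, ?_⟩
  · exact (hH.piecewiseAffine v hvV).comp (hφ.piecewiseAffine.prodMk
      (hφ.piecewiseAffine.isPolyhedral.piecewiseAffine AffineMap.snd))
      fun p hp => ⟨hφ.mapsTo hp, hp.2⟩
  · exact fun p hp => hH.mapsTo v hvV ⟨hφ.mapsTo hp, hp.2⟩
  · intro x hx
    simp only
    rw [hφ.zero x hx, hH.zero v hvV x hx]
  · intro u hu x hx y hy hxy
    exact hφ.injOn u hu hx hy (hH.injOn v hvV u hu (hmem x hx u hu) (hmem y hy u hu) hxy)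
  · intro x hx hxW u
    simp only
    rw [hφ.off x hx (fun h => hxW (.inl h)) u, hH.off v hvV x hx (fun h => hxW (.inr h))]
  · intro s hs t ht
    refine ((hφ.track s hs t ht).union (hv1 s hs t ht hvV)).mono ?_
    rintro w ⟨hwt, x, hxs, hxW, u, hu, rfl⟩
    by_cases hS : φ (x, u) ∈ S
    · obtain ⟨a, ha, rfl⟩ := hC s hs x hxs
      exact .inr ⟨hC t ht _ hwt, (a, u), ⟨ha, hu⟩, hS, rfl⟩
    · have h1 : H v (φ (x, u), u) = φ (x, u) :=
        hH.off v hvV _ (hmem x (hKM s hs hxs) u (Ioc_subset_Icc_self hu)) hS u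
      simp only at hwt ⊢
      rw [h1] at hwt ⊢
      refine .inl ⟨hwt, x, hxs, ?_, u, hu, rfl⟩
      by_contra hxW'
      rw [hφ.off x (hKM s hs hxs) hxW'] at hS
      exact hS (hxW.resolve_left hxW')
  · intro s hs t ht
    refine ((hφ.final s hs t ht).union (hv2 s hs t ht hvV)).mono ?_
    rintro w ⟨hwt, x, hxs, hxW, rfl⟩
    by_cases hS : φ (x, 1) ∈ S
    · obtain ⟨a, ha, rfl⟩ := hC s hs x hxs
      exact .inr ⟨hC t ht _ hwt, a, ha, hS, rfl⟩
    · have h1 : H v (φ (x, 1), 1) = φ (x, 1) :=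
        hH.off v hvV _ (hmem x (hKM s hs hxs) 1 (by simp)) hS 1
      simp only at hwt ⊢
      rw [h1] at hwt ⊢
      refine .inl ⟨hwt, x, hxs, ?_, rfl⟩
      by_contra hxW'
      rw [hφ.off x (hKM s hs hxs) hxW'] at hS
      exact hS (hxW.resolve_left hxW')

theorem IsCompactPLManifold.exists_isGenericHomotopy [FiniteDimensional ℝ E]
    (hM : IsCompactPLManifold m M) (hK : IsTriangulation K M) :
    ∃ W φ, M ⊆ W ∧ IsGenericHomotopy m M K W φ := by
  classical
  choose! N hN hNM hmoves using fun x (hx : x ∈ M) => hM.exists_hasMoves hx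
  obtain ⟨T, hTM, hcov⟩ := hK.isCompact.elim_nhdsWithin_subcover N hN
  suffices h : ∀ T : Finset E, (∀ x ∈ T, x ∈ M) →
      ∃ φ, IsGenericHomotopy m M K (⋃ x ∈ T, N x) φ by
    obtain ⟨φ, hφ⟩ := h T hTM
    exact ⟨_, φ, hcov, hφ⟩
  intro T
  induction T using Finset.induction_on with
  | empty =>
    intro _
    exact ⟨Prod.fst, by simpa using isGenericHomotopy_fst hK.isPolyhedral⟩
  | insert x T _ ih =>
    intro hT
    obtain ⟨φ, hφ⟩ := ih fun y hy => hT y (by simp [hy])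
    obtain ⟨V, H, B, h, hH⟩ := hmoves x (hT x (by simp))
    obtain ⟨φ', hφ'⟩ := hφ.exists_extend hK hH
    refine ⟨φ', ?_⟩
    rwa [Finset.set_biUnion_insert, union_comm]

variable [FiniteDimensional ℝ E] {W : Set E} {φ : E × ℝ → E}

theorem IsGenericHomotopy.inGeneralPosition (hφ : IsGenericHomotopy m M K W φ)
    (hK : IsTriangulation K M) (hW : M ⊆ W) {s t : Finset E} (hs : s ∈ K.faces)
    (ht : t ∈ K.faces) : InGeneralPosition m ((fun x => φ (x, 1)) '' convexHull ℝ (s : Set E))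
      (convexHull ℝ (t : Set E)) := by
  have hsM : convexHull ℝ (s : Set E) ⊆ M := by
    rw [← hK.2]; exact Geometry.SimplicialComplex.convexHull_subset_space hs
  have hne : ∀ s ∈ K.faces, (convexHull ℝ (s : Set E)).Nonempty := fun s hs =>
    (Finset.coe_nonempty.2 (K.nonempty_of_mem_faces hs)).convexHull
  have hPA : IsPiecewiseAffine (fun x => φ (x, 1)) M :=
    hφ.piecewiseAffine.comp_affine hK.isPolyhedral
      ((AffineMap.id ℝ E).prod (AffineMap.const ℝ E (1 : ℝ))) fun x hx => ⟨hx, by simp⟩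
  have h1 := hPA.finrank_le_dim_image hsM (convex_convexHull ℝ _) (hne s hs)
    ((hφ.injOn 1 (by simp)).mono hsM)
  have h2 := (convex_convexHull ℝ (t : Set E)).finrank_le_dim (hne t ht)
  have hD := hφ.final s hs t ht
  set ds := Module.finrank ℝ (vectorSpan ℝ (convexHull ℝ (s : Set E)))
  set dt := Module.finrank ℝ (vectorSpan ℝ (convexHull ℝ (t : Set E)))
  have hsub : (fun x => φ (x, 1)) '' convexHull ℝ (s : Set E) ∩ convexHull ℝ (t : Set E) ⊆
      {w ∈ convexHull ℝ (t : Set E) | ∃ x ∈ convexHull ℝ (s : Set E), x ∈ W ∧ φ (x, 1) = w} := by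
    rintro _ ⟨⟨x, hx, rfl⟩, hw⟩
    exact ⟨hw, x, hx, hW (hsM hx), rfl⟩
  have hD' := hD.mono hsub
  refine dim_le_of_forall_le_dimH fun hA k hk => ?_
  -- The subtraction in `DimLESub` is truncated; nonemptiness rules out a negative expected
  -- dimension.
  have hm : m ≤ ds + dt := by
    by_contra! hlt
    exact hA.ne_empty (hD'.1 hlt)
  have hk' : k ≤ ds + dt - m := by exact_mod_cast hk.trans hD'.2
  refine le_trans ?_ (EReal.sub_le_sub (add_le_add h1 h2) le_rfl)
  have : (k : ℝ) ≤ ds + dt - m := by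
    have : k + m ≤ ds + dt := by omega
    have : (k : ℝ) + m ≤ ds + dt := by exact_mod_cast this
    linarith
  exact_mod_cast this

/-- At time `0` the homotopy is the identity and contributes only the intersection of the two
simplices; positive times are governed by `track`. -/
theorem IsGenericHomotopy.dim_track_le (hφ : IsGenericHomotopy m M K W φ)
    (hK : IsTriangulation K M) (hW : M ⊆ W) {s t : Finset E} (hs : s ∈ K.faces)
    (ht : t ∈ K.faces) :
    dim (φ '' (convexHull ℝ (s : Set E) ×ˢ Icc (0 : ℝ) 1) ∩ convexHull ℝ (t : Set E)) ≤
      max (dim (convexHull ℝ (s : Set E)) + 1 + dim (convexHull ℝ (t : Set E)) -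
        ((m : ℝ) : EReal)) (dim (convexHull ℝ (s : Set E) ∩ convexHull ℝ (t : Set E))) := by
  have hsM : convexHull ℝ (s : Set E) ⊆ M := by
    rw [← hK.2]; exact Geometry.SimplicialComplex.convexHull_subset_space hs
  have hne : ∀ s ∈ K.faces, (convexHull ℝ (s : Set E)).Nonempty := fun s hs =>
    (Finset.coe_nonempty.2 (K.nonempty_of_mem_faces hs)).convexHull
  have h1 := (convex_convexHull ℝ (s : Set E)).finrank_le_dim (hne s hs)
  have h2 := (convex_convexHull ℝ (t : Set E)).finrank_le_dim (hne t ht)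
  have hD := hφ.track s hs t ht
  have hconv : Convex ℝ (convexHull ℝ (s : Set E) ∩ convexHull ℝ (t : Set E)) :=
    (convex_convexHull ℝ _).inter (convex_convexHull ℝ _)
  set T := {w ∈ convexHull ℝ (t : Set E) | ∃ x ∈ convexHull ℝ (s : Set E),
        x ∈ W ∧ ∃ u ∈ Ioc (0 : ℝ) 1, φ (x, u) = w}
  set I := convexHull ℝ (s : Set E) ∩ convexHull ℝ (t : Set E)
  set ds := Module.finrank ℝ (vectorSpan ℝ (convexHull ℝ (s : Set E)))
  set dt := Module.finrank ℝ (vectorSpan ℝ (convexHull ℝ (t : Set E)))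
  have hsub : φ '' (convexHull ℝ (s : Set E) ×ˢ Icc (0 : ℝ) 1) ∩ convexHull ℝ (t : Set E) ⊆
      T ∪ I := by
    rintro _ ⟨⟨⟨x, u⟩, ⟨hx, hu⟩, rfl⟩, hw⟩
    rcases eq_or_lt_of_le hu.1 with h | h
    · right
      simp only at h
      rw [← h, hφ.zero x (hsM hx)] at hw ⊢
      exact ⟨hx, hw⟩
    · exact .inl ⟨hw, x, hx, hW (hsM hx), u, ⟨h, hu.2⟩, rfl⟩
  refine dim_le_of_forall_le_dimH fun hA k hk => ?_
  have hk2 := hk.trans (dimH_mono hsub)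
  rw [dimH_union] at hk2
  -- Nonemptiness is carried along because `dimH ∅ = 0` would let an empty set account for `k = 0`.
  by_cases hI : I.Nonempty ∧ (k : ENNReal) ≤ dimH I
  · refine le_max_of_le_right (le_trans ?_ (hconv.finrank_le_dim hI.1))
    have h3 := hI.2
    rw [Real.Convex.dimH_eq_finrank_vectorSpan hconv hI.1] at h3
    exact_mod_cast h3
  · have hT : T.Nonempty ∧ (k : ENNReal) ≤ dimH T := by
      rcases I.eq_empty_or_nonempty with h | h
      · rw [h, union_empty] at hsub
        exact ⟨hA.mono hsub, hk.trans (dimH_mono hsub)⟩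
      · have h3 : ¬ (k : ENNReal) ≤ dimH I := fun h4 => hI ⟨h, h4⟩
        have h4 := (le_max_iff.1 hk2).resolve_right h3
        refine ⟨?_, h4⟩
        by_contra hT
        rw [not_nonempty_iff_eq_empty] at hT
        rw [hT, dimH_empty] at h4
        exact h3 (h4.trans zero_le)
    refine le_max_of_le_left ?_
    have hm : m ≤ ds + 1 + dt := by
      by_contra! hlt
      exact hT.1.ne_empty (hD.1 hlt)
    have hk' : k ≤ ds + 1 + dt - m := by exact_mod_cast hT.2.trans hD.2
    refine le_trans ?_ (EReal.sub_le_sub (add_le_add (add_le_add h1 le_rfl) h2) le_rfl)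
    have : (k : ℝ) ≤ ds + 1 + dt - m := by
      have : k + m ≤ ds + 1 + dt := by omega
      have : (k : ℝ) + m ≤ ds + 1 + dt := by exact_mod_cast this
      linarith
    exact_mod_cast this

end Moves

end PL

theorem proposition14p6 (n m : ℕ) (M : Set (EuclideanSpace ℝ (Fin n)))
    (hM : PL.IsCompactPLManifold m M)
    (K : Geometry.SimplicialComplex ℝ (EuclideanSpace ℝ (Fin n)))
    (hK : PL.IsTriangulation K M) :
    ∃ φ : EuclideanSpace ℝ (Fin n) × ℝ → EuclideanSpace ℝ (Fin n),
      PL.IsPLMap φ (M ×ˢ Set.Icc (0 : ℝ) 1) M ∧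
      (∀ x ∈ M, φ (x, 0) = x) ∧
      (∀ s ∈ K.faces, ∀ t ∈ K.faces,
        PL.InGeneralPosition m
          ((fun x => φ (x, 1)) '' convexHull ℝ (s : Set (EuclideanSpace ℝ (Fin n))))
          (convexHull ℝ (t : Set (EuclideanSpace ℝ (Fin n))))) ∧
      (∀ s ∈ K.faces, ∀ t ∈ K.faces,
        PL.dim
            (φ '' (convexHull ℝ (s : Set (EuclideanSpace ℝ (Fin n))) ×ˢ Set.Icc (0 : ℝ) 1) ∩
              convexHull ℝ (t : Set (EuclideanSpace ℝ (Fin n)))) ≤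
          max
            (PL.dim (convexHull ℝ (s : Set (EuclideanSpace ℝ (Fin n)))) + 1 +
              PL.dim (convexHull ℝ (t : Set (EuclideanSpace ℝ (Fin n)))) - ((m : ℝ) : EReal))
            (PL.dim
              (convexHull ℝ (s : Set (EuclideanSpace ℝ (Fin n))) ∩
                convexHull ℝ (t : Set (EuclideanSpace ℝ (Fin n)))))) := by
  obtain ⟨W, φ, hW, hφ⟩ := hM.exists_isGenericHomotopy hK
  refine ⟨φ, hφ.piecewiseAffine.isPLMap (hK.isCompact.prod isCompact_Icc).isBounded hφ.mapsTo hK,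
    hφ.zero, fun s hs t ht => hφ.inGeneralPosition hK hW hs ht,
    fun s hs t ht => hφ.dim_track_le hK hW hs ht⟩
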